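/- For a graph $F$ and a positive integer $n$, let $\mathrm{regex}(n,F)$ be the maximum $r$ such that there is an $r$-regular graph on $n$ vertices containing no copy of $F$ as a (not necessarily induced) subgraph. A tree is a star if one of its vertices is adjacent to all the others, and an almost-star if one of the two classes of its proper 2-coloring has at most two vertices. Let $T$ be a tree on $t\ge 2$ vertices. There is an $n_0(T)$, depending only on $T$, such that for every integer $n>n_0(T)$ the number $\mathrm{regex}(n,T)$ exists and 1. $\mathrm{regex}(n,T)=t-2$ if $t-1$ divides $n$, or $T$ is a star and at least one of $t$, $n$ is even; 2. $\mathrm{regex}(n,T)=t-3$ if 1 does not apply and at least one of the following holds: $t$ is odd; $t-2$ divides $n$; $T$ is a star; $T$ is an almost-star and $n$ is even; 3. $\mathrm{regex}(n,T)=t-4$ in all remaining cases. -/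

import Mathlib

/-- The degrees `r` for which there is an `r`-regular graph on `n` vertices that contains no copy
of `F` as a (not necessarily induced) subgraph. -/
def regularFreeDegrees {V : Type*} (n : ℕ) (F : SimpleGraph V) : Set ℕ :=
  {r | ∃ (G : SimpleGraph (Fin n)) (_ : G.LocallyFinite), G.IsRegularOfDegree r ∧ F.Free G}

/-- The regular Turán number in its degree form: the maximum `r` such that there is an `r`-regular
`F`-free graph on `n` vertices. It is meaningful when `regularFreeDegrees n F` has a maximum. -/
noncomputable def regex {V : Type*} (n : ℕ) (F : SimpleGraph V) : ℕ :=
  sSup (regularFreeDegrees n F)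

/-- A star: some vertex (the center) is adjacent to all others and there are no further edges. -/
def IsStar {V : Type*} (T : SimpleGraph V) : Prop :=
  ∃ c : V, T = SimpleGraph.starGraph c

/-- An almost-star: a tree one of whose classes in its proper 2-coloring has at most two
vertices. -/
def IsAlmostStar {V : Type*} (T : SimpleGraph V) : Prop :=
  T.IsTree ∧ ∃ (C : T.Coloring (Fin 2)) (i : Fin 2), (C.colorClass i).encard ≤ 2

/-- The case in which the value is `t - 2`, where `t` is the number of vertices of `T`. -/
def TopCase {V : Type*} (T : SimpleGraph V) (t n : ℕ) : Prop :=
  t - 1 ∣ n ∨ (IsStar T ∧ (Even t ∨ Even n))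

/-- The conditions under which, outside the previous case, the value is `t - 3`. -/
def MiddleCase {V : Type*} (T : SimpleGraph V) (t n : ℕ) : Prop :=
  Odd t ∨ t - 2 ∣ n ∨ IsStar T ∨ (IsAlmostStar T ∧ Even n)

/-!
Write `t` for the order of the tree `T`.

*Upper bounds.* A graph of minimum degree at least `t - 1` contains `T` greedily, so only degrees
`d ≤ t - 2` matter. A partial copy of `T` is an embedding of a subtree; it extends greedily while at
most `d` vertices are used, and beyond that as soon as the image of the vertex `p` to which the next
leaf is attached *misses* (is not adjacent to) enough vertices of the image
(`PartialCopy.exists_free`, `PartialCopy.exists_extend`).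

For `d = t - 2` one miss is enough: an induced path `x y z` of a connected graph that is not
complete serves as image of a path `p r s` of `T`, where `p` is adjacent to a leaf that is placed
last. So a connected `d`-regular graph other than `K_{d+1}` contains every tree on `d + 2` vertices
other than the star (`Connected.isContained_of_not_isStar`).

For `d = t - 3` the last two vertices need one and two misses. A connected `d`-regular graph on at
least `d + 3` vertices is complete multipartite, or it has a path `x y z w` with `x` adjacent
neither to `z` nor to `w` (`Connected.exists_path_or_twins`). From this one gets, for any vertex `p`
of a subtree in which two more vertices have its color, a partial copy with two misses at `p`
(`Connected.exists_partialCopy_two_misses`). If `p` is adjacent to two leaves, both can then be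
placed. If no vertex is adjacent to two leaves, then `T` has two pendant paths `l p p'` and
`m q q'` of length two, found at the leaves `p`, `q` of the tree left when all leaves of `T` are
removed. The leaves `l`, `m` can be placed as above unless the image of `q` is adjacent to the whole
image; but then the images of `q` and of a suitable other vertex can be exchanged
(`PartialCopy.swap`). The two vertices of the color of `p` must differ from `m`, which is possible
except for the path on six vertices, treated separately. Hence every tree on `d + 3` vertices whose
color classes both have at least three vertices is contained
(`Connected.isContained_of_three_le_colorClass`). Divisibility conditions come from components
`K_{d+1}`, and parity excludes components of order `d + 2` and odd `n` when `d` is odd.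

*Lower bounds.* A disjoint union of `T`-free graphs is `T`-free. The pieces are `K_{d+1}`, the
complete graph on `d + 2` vertices minus a perfect matching (`d` even), and `K_{d,d}`; by the
solution of the coin problem for two denominations their unions reach all large orders that are
multiples of the greatest common divisor of the orders of the pieces.
-/

/-! ### Partial copies and greedy extension -/

namespace SimpleGraph

variable {V W : Type*}

/-- In a forest, a vertex outside a connected set has at most one neighbor in that set. -/
lemma IsAcyclic.eq_of_adj_of_preconnected_induce {T : SimpleGraph V} (hT : T.IsAcyclic)
    {s : Set V} (hs : (T.induce s).Preconnected) {v a b : V} (hv : v ∉ s) (ha : a ∈ s)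
    (hb : b ∈ s) (hav : T.Adj a v) (hbv : T.Adj b v) : a = b := by
  by_contra hne
  obtain ⟨w, hw⟩ := hs.exists_isPath ⟨a, ha⟩ ⟨b, hb⟩
  have hp : (w.map (Embedding.induce s).toHom).IsPath :=
    hw.map (Embedding.induce (G := T) s).injective
  have hq : (Walk.cons hav (Walk.cons hbv.symm Walk.nil)).IsPath := by
    simp [hav.ne, hbv.ne', hne]
  have hsupp : ∀ x ∈ (w.map (Embedding.induce s).toHom).support, x ∈ s := by
    intro x hx
    rw [Walk.support_map, List.mem_map] at hx
    obtain ⟨y, -, rfl⟩ := hx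
    exact y.2
  have h := congrArg (fun p : T.Path a b ↦ v ∈ p.1.support)
    ((hT.subsingleton_path a b).elim ⟨_, hp⟩ ⟨_, hq⟩)
  exact hv (hsupp v (by simpa using h))

/-- Adding to a connected set a vertex adjacent to one of its members keeps it connected. -/
lemma preconnected_induce_insert {T : SimpleGraph V} {s : Set V}
    (hs : (T.induce s).Preconnected) {u v : V} (hu : u ∈ s) (huv : T.Adj u v) :
    (T.induce (insert v s)).Preconnected := by
  have h := induce_union_connected hs (induce_pair_connected_of_adj huv).preconnected
    ⟨u, hu, Set.mem_insert u {v}⟩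
  have : s ∪ {u, v} = insert v s := by grind
  rw [this] at h
  exact h.preconnected

/-- `φ` maps the subtree of `T` with vertex set `S` injectively and edge-preservingly into `G`. -/
structure PartialCopy (T : SimpleGraph V) (G : SimpleGraph W) (S : Finset V) (φ : V → W) :
    Prop where
  conn : (T.induce (S : Set V)).Preconnected
  inj : Set.InjOn φ S
  adj : ∀ ⦃u⦄, u ∈ S → ∀ ⦃v⦄, v ∈ S → T.Adj u v → G.Adj (φ u) (φ v)

namespace PartialCopy

variable {T : SimpleGraph V} {G : SimpleGraph W} {S : Finset V} {φ : V → W}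

lemma singleton (v : V) : PartialCopy T G {v} φ where
  conn := by
    rw [Finset.coe_singleton]
    exact Preconnected.of_subsingleton
  inj := by simp
  adj := by
    intro a ha b hb hab
    simp only [Finset.mem_singleton] at ha hb
    subst ha hb
    exact (hab.ne rfl).elim

lemma isContained [Fintype V] (h : PartialCopy T G Finset.univ φ) : T.IsContained G :=
  ⟨⟨⟨φ, fun {a b} hab ↦ h.adj (Finset.mem_univ a) (Finset.mem_univ b) hab⟩,
    fun a b hab ↦ h.inj (by simp) (by simp) hab⟩⟩

variable [DecidableEq V]

lemma insert (h : PartialCopy T G S φ) (hT : T.IsAcyclic) {u v : V} {w : W} (hu : u ∈ S)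
    (hv : v ∉ S) (huv : T.Adj u v) (hw : ∀ a ∈ S, φ a ≠ w) (huw : G.Adj (φ u) w) :
    PartialCopy T G (insert v S) (Function.update φ v w) where
  conn := by
    rw [Finset.coe_insert]
    exact preconnected_induce_insert h.conn hu huv
  inj := by
    intro a ha b hb hab
    have := h.inj
    simp only [Set.InjOn, Finset.mem_coe, Finset.mem_insert, Function.update_apply] at *
    grind
  adj := by
    have key : ∀ a ∈ S, T.Adj a v → a = u := fun a ha hav ↦
      hT.eq_of_adj_of_preconnected_induce h.conn (by simpa using hv) (by simpa using ha)
        (by simpa using hu) hav huv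
    intro a ha b hb hab
    have hne := hab.ne
    have h1 := hab.symm
    have h2 := huw.symm
    have := h.adj
    simp only [Finset.mem_insert, Function.update_apply] at *
    grind

lemma exists_insert (h : PartialCopy T G S φ) (hT : T.IsAcyclic) {u v : V} {w : W} (hu : u ∈ S)
    (hv : v ∉ S) (huv : T.Adj u v) (hw : ∀ a ∈ S, φ a ≠ w) (huw : G.Adj (φ u) w) :
    ∃ ψ, PartialCopy T G (Insert.insert v S) ψ ∧ (∀ a ∈ S, ψ a = φ a) ∧ ψ v = w :=
  ⟨_, h.insert hT hu hv huv hw huw, fun a ha ↦ by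
    rw [Function.update_of_ne]; rintro rfl; exact hv ha, by simp⟩

variable [Fintype W] [DecidableEq W] [DecidableRel G.Adj]

omit [DecidableEq V] in
/-- In minimum degree at least `d`, a set `M` of vertices of the image that are not adjacent to `φ u`
ensures that `φ u` has a neighbor outside the image as long as `S` has at most `d + M.card`
elements. -/
lemma exists_free {d : ℕ} (hd : ∀ x, d ≤ G.degree x) {u : V} (hu : u ∈ S) (M : Finset W)
    (hM : M ⊆ S.image φ) (hMu : φ u ∉ M) (hMadj : ∀ z ∈ M, ¬ G.Adj (φ u) z)
    (hS : S.card ≤ d + M.card) : ∃ w, G.Adj (φ u) w ∧ ∀ a ∈ S, φ a ≠ w := by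
  by_contra! hcon
  have hsub : G.neighborFinset (φ u) ⊆ (S.image φ \ M).erase (φ u) := by
    intro w hw
    rw [mem_neighborFinset] at hw
    obtain ⟨a, ha, rfl⟩ := hcon w hw
    simp only [Finset.mem_erase, Finset.mem_sdiff, Finset.mem_image]
    exact ⟨hw.ne', ⟨a, ha, rfl⟩, fun h ↦ hMadj _ h hw⟩
  have h1 := Finset.card_le_card hsub
  have hmem : φ u ∈ S.image φ \ M := by
    simp only [Finset.mem_sdiff, Finset.mem_image]
    exact ⟨⟨u, hu, rfl⟩, hMu⟩
  rw [Finset.card_erase_of_mem hmem, Finset.card_sdiff_of_subset hM,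
    card_neighborFinset_eq_degree] at h1
  have h2 := hd (φ u)
  have h3 : (S.image φ).card ≤ S.card := Finset.card_image_le
  have h4 : 0 < (S.image φ \ M).card := Finset.card_pos.2 ⟨_, hmem⟩
  rw [Finset.card_sdiff_of_subset hM] at h4
  lia

/-- Greedy extension: in a graph of minimum degree at least `d`, a partial copy extends to any
larger subtree with at most `d + 1` vertices. -/
lemma exists_extend {d : ℕ} (hd : ∀ x, d ≤ G.degree x) (hT : T.IsAcyclic) {S' : Finset V}
    (hS' : (T.induce (S' : Set V)).Preconnected) (hcard : S'.card ≤ d + 1) :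
    ∀ {S : Finset V} {φ : V → W}, PartialCopy T G S φ → S.Nonempty → S ⊆ S' →
      ∃ ψ, PartialCopy T G S' ψ ∧ ∀ a ∈ S, ψ a = φ a := by
  intro S
  induction hk : S'.card - S.card generalizing S with
  | zero =>
    intro φ h _ hsub
    have : S = S' := Finset.eq_of_subset_of_card_le hsub (by lia)
    subst this
    exact ⟨φ, h, fun _ _ ↦ rfl⟩
  | succ k ih =>
    intro φ h ⟨u₀, hu₀⟩ hsub
    have hne : ∃ v₀ ∈ S', v₀ ∉ S := by
      by_contra! hcon
      have := Finset.card_le_card hcon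
      lia
    obtain ⟨v₀, hv₀, hv₀S⟩ := hne
    obtain ⟨p⟩ := hS' ⟨u₀, hsub hu₀⟩ ⟨v₀, hv₀⟩
    obtain ⟨e, -, he1, he2⟩ := p.exists_boundary_dart {x | (x : V) ∈ S} hu₀ hv₀S
    have hadj : T.Adj (e.fst : V) (e.snd : V) := e.adj
    have hlt : S.card < S'.card :=
      Finset.card_lt_card ⟨hsub, fun hh ↦ hv₀S (hh hv₀)⟩
    obtain ⟨w, hw1, hw2⟩ := exists_free hd (φ := φ) he1 ∅ (by simp) (by simp) (by simp)
      (by rw [Finset.card_empty]; lia)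
    obtain ⟨ψ, hψ, hψS, -⟩ := h.exists_insert hT he1 he2 hadj hw2 hw1
    obtain ⟨χ, hχ, hχS⟩ := ih (S := Insert.insert (e.snd : V) S)
      (by rw [Finset.card_insert_of_notMem he2]; lia) hψ ⟨u₀, by simp [hu₀]⟩
      (Finset.insert_subset e.snd.2 hsub)
    exact ⟨χ, hχ, fun a ha ↦ by rw [hχS a (by simp [ha]), hψS a ha]⟩

end PartialCopy

end SimpleGraph

/-! ### Nonadjacent vertices in connected regular graphs -/

namespace SimpleGraph

variable {V W : Type*}

section Host

variable [Fintype W] [DecidableEq W] {G : SimpleGraph W}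

omit [DecidableEq W] in
lemma Connected.exists_adj_of_card_lt (hG : G.Connected) {C : Finset W} (hC : C.Nonempty)
    (h : C.card < Fintype.card W) : ∃ a ∈ C, ∃ b ∉ C, G.Adj a b := by
  obtain ⟨u, hu⟩ := hC
  obtain ⟨v, hv⟩ : ∃ v, v ∉ C := by
    by_contra! hcon
    rw [Finset.eq_univ_iff_forall.2 hcon, Finset.card_univ] at h
    exact h.false
  obtain ⟨p⟩ := hG.preconnected u v
  obtain ⟨e, -, he1, he2⟩ := p.exists_boundary_dart (C : Set W) hu hv
  exact ⟨_, he1, _, he2, e.adj⟩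

variable [DecidableRel G.Adj] {d : ℕ}

lemma IsRegularOfDegree.card_insert_neighborFinset (hd : G.IsRegularOfDegree d) (x : W) :
    (insert x (G.neighborFinset x)).card = d + 1 := by
  rw [Finset.card_insert_of_notMem (by simp), card_neighborFinset_eq_degree, hd x]

/-- A connected regular graph that is not complete contains an induced path on three vertices. -/
lemma Connected.exists_induced_path (hG : G.Connected) (hd : G.IsRegularOfDegree d)
    (hcard : d + 2 ≤ Fintype.card W) :
    ∃ x y z, G.Adj x y ∧ G.Adj y z ∧ x ≠ z ∧ ¬ G.Adj x z := by
  obtain ⟨x⟩ := hG.nonempty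
  obtain ⟨y, hy, z, hz, hyz⟩ := hG.exists_adj_of_card_lt (C := insert x (G.neighborFinset x))
    (by simp) (by rw [hd.card_insert_neighborFinset]; lia)
  simp only [Finset.mem_insert, mem_neighborFinset, not_or] at hy hz
  rcases hy with rfl | hy
  · exact (hz.2 hyz).elim
  · exact ⟨x, y, z, hy, hyz, Ne.symm hz.1, hz.2⟩

/-- In a regular graph, if `y` has a neighbor outside the closed neighborhood of its neighbor `x`,
then `x` has a neighbor outside the closed neighborhood of `y`. -/
lemma IsRegularOfDegree.exists_private_neighbor (hd : G.IsRegularOfDegree d) {x y z : W}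
    (hxy : G.Adj x y) (hyz : G.Adj y z) (hxz : x ≠ z) (hnadj : ¬ G.Adj x z) :
    ∃ a, G.Adj x a ∧ a ≠ y ∧ ¬ G.Adj y a := by
  by_contra! hcon
  have hsub : insert x (G.neighborFinset x) ⊆ insert y (G.neighborFinset y) := by
    intro a ha
    have := hcon a
    have := hxy.symm
    simp only [Finset.mem_insert, mem_neighborFinset] at *
    grind
  have h := Finset.eq_of_subset_of_card_le hsub
    (by rw [hd.card_insert_neighborFinset, hd.card_insert_neighborFinset])
  have hz : z ∈ insert x (G.neighborFinset x) := by rw [h]; simp [hyz]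
  simp [hnadj, hxz.symm] at hz

/-- A connected regular graph is either complete multipartite with parts of at least three
vertices (expressed here by the existence of two twins of each vertex), or contains a path `x y z w`
in which `x` is adjacent neither to `z` nor to `w`. -/
lemma Connected.exists_path_or_twins (hG : G.Connected) (hd : G.IsRegularOfDegree d)
    (hcard : d + 3 ≤ Fintype.card W) :
    (∃ x y z w, G.Adj x y ∧ G.Adj y z ∧ G.Adj z w ∧ x ≠ z ∧ ¬ G.Adj x z ∧ ¬ G.Adj x w) ∨
    ∀ x, ∃ z₁ z₂, z₁ ≠ z₂ ∧ z₁ ≠ x ∧ z₂ ≠ x ∧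
      ∀ u, (G.Adj z₁ u ↔ G.Adj x u) ∧ (G.Adj z₂ u ↔ G.Adj x u) := by
  by_contra! hcon
  obtain ⟨hpath, x, hx⟩ := hcon
  have htwin : ∀ z, z ≠ x → ¬ G.Adj x z → ∀ u, G.Adj z u ↔ G.Adj x u := by
    have key : ∀ y z, G.Adj x y → G.Adj y z → x ≠ z → ¬ G.Adj x z → ∀ u, G.Adj z u ↔ G.Adj x u :=
      fun y z hxy hyz hne hnadj u ↦ ⟨fun h ↦ hpath x y z u hxy hyz h hne hnadj,
        fun h ↦ hpath z y x u hyz.symm hxy.symm h hne.symm (fun h ↦ hnadj h.symm)⟩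
    by_contra! hcon
    obtain ⟨v, hvx, hvadj, u, hu⟩ := hcon
    -- the vertices equal to, adjacent to, or twins of `x` form a closed set
    obtain ⟨a, ha, b, hb, hab⟩ := hG.exists_adj_of_card_lt
      (C := Finset.univ.filter fun z ↦ z = x ∨ G.Adj x z ∨ ∀ u, G.Adj z u ↔ G.Adj x u)
      ⟨x, by simp⟩ (by
        rw [← Finset.card_univ]
        refine Finset.card_lt_card ⟨Finset.filter_subset _ _, fun h ↦ ?_⟩
        have := h (Finset.mem_univ v)
        simp only [Finset.mem_filter, Finset.mem_univ, true_and] at this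
        grind)
    simp only [Finset.mem_filter, Finset.mem_univ, true_and, not_or] at ha hb
    rcases ha with rfl | ha | ha
    · exact hb.2.1 hab
    · exact hb.2.2 (key a b ha hab (Ne.symm hb.1) hb.2.1)
    · exact hb.2.1 ((ha b).1 hab)
  have hc : 1 < (Finset.univ \ insert x (G.neighborFinset x)).card := by
    rw [Finset.card_sdiff_of_subset (Finset.subset_univ _), hd.card_insert_neighborFinset,
      Finset.card_univ]
    lia
  obtain ⟨z₁, h₁, z₂, h₂, hne⟩ := Finset.one_lt_card.1 hc
  simp only [Finset.mem_sdiff, Finset.mem_univ, Finset.mem_insert, mem_neighborFinset, not_or,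
    true_and] at h₁ h₂
  obtain ⟨u, hu⟩ := hx z₁ z₂ hne h₁.1 h₂.1
  have h3 := htwin z₁ h₁.1 h₁.2 u
  have h4 := htwin z₂ h₂.1 h₂.2 u
  grind

omit [DecidableEq W] in
lemma IsRegularOfDegree.exists_two_neighbors (hd : G.IsRegularOfDegree d) (hd2 : 2 ≤ d) (x : W) :
    ∃ y₁ y₂, G.Adj x y₁ ∧ G.Adj x y₂ ∧ y₁ ≠ y₂ := by
  have h : 1 < (G.neighborFinset x).card := by
    rw [card_neighborFinset_eq_degree, hd x]; lia
  obtain ⟨y₁, h₁, y₂, h₂, hne⟩ := Finset.one_lt_card.1 h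
  rw [mem_neighborFinset] at h₁ h₂
  exact ⟨y₁, y₂, h₁, h₂, hne⟩

lemma IsRegularOfDegree.exists_neighbor_ne (hd : G.IsRegularOfDegree d) (hd3 : 3 ≤ d) (x a b : W) :
    ∃ y, G.Adj x y ∧ y ≠ a ∧ y ≠ b := by
  have h : ({a, b} : Finset W).card < (G.neighborFinset x).card := by
    rw [card_neighborFinset_eq_degree, hd x]
    have := Finset.card_le_two (a := a) (b := b)
    lia
  obtain ⟨y, hy, hy'⟩ := Finset.exists_mem_notMem_of_card_lt_card h
  simp only [mem_neighborFinset, Finset.mem_insert, Finset.mem_singleton, not_or] at hy hy'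
  exact ⟨y, hy, hy'⟩

/-- Some edge `xy` is such that two neighbors of `y` lie outside the closed neighborhood
of `x`. -/
lemma Connected.exists_adj_two_private (hG : G.Connected) (hd : G.IsRegularOfDegree d)
    (hd3 : 3 ≤ d) (hcard : d + 3 ≤ Fintype.card W) :
    ∃ x y z₁ z₂, G.Adj x y ∧ G.Adj y z₁ ∧ G.Adj y z₂ ∧ z₁ ≠ z₂ ∧ z₁ ≠ x ∧ z₂ ≠ x ∧
      ¬ G.Adj x z₁ ∧ ¬ G.Adj x z₂ := by
  rcases hG.exists_path_or_twins hd hcard with ⟨x, y, z, w, hxy, hyz, hzw, hne, hxz, hxw⟩ | h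
  · by_contra! hcon
    obtain ⟨v, hyv, hvx, hvz⟩ := hd.exists_neighbor_ne hd3 y x z
    have hyw : ¬ G.Adj y w := fun hyw ↦ hxw <|
      hcon x y z w hxy hyz hyw hzw.ne hne.symm (by rintro rfl; exact hxz hzw.symm) hxz
    have hxv := hcon x y z v hxy hyz hyv hvz.symm hne.symm hvx hxz
    have hzv := hcon z y x v hyz.symm hxy.symm hyv hvx.symm hne hvz (fun h ↦ hxz h.symm)
    have hwv := hcon w z y v hzw.symm hyz.symm hzv hyv.ne (by rintro rfl; exact hxw hxy)
      (by rintro rfl; exact hxw hxv) (fun h ↦ hyw h.symm)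
    exact hxw <| hcon x v z w hxv hzv.symm hwv.symm hzw.ne hne.symm
      (by rintro rfl; exact hxz hzw.symm) hxz
  · obtain ⟨x⟩ := hG.nonempty
    obtain ⟨y, -, hxy, -, -⟩ := hd.exists_two_neighbors (by lia) x
    obtain ⟨z₁, z₂, hne, h₁, h₂, hz⟩ := h x
    refine ⟨x, y, z₁, z₂, hxy, ((hz y).1.2 hxy).symm, ((hz y).2.2 hxy).symm, hne, h₁, h₂,
      fun h ↦ ?_, fun h ↦ ?_⟩
    · exact G.loopless.irrefl x ((hz x).1.1 h.symm)
    · exact G.loopless.irrefl x ((hz x).2.1 h.symm)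

/-- Some vertex `x` is such that there are two disjoint edges between its neighborhood and the
complement of its closed neighborhood. -/
lemma Connected.exists_two_disjoint_exits (hG : G.Connected) (hd : G.IsRegularOfDegree d)
    (hd2 : 2 ≤ d) (hcard : d + 3 ≤ Fintype.card W) :
    ∃ x y₁ y₂ z₁ z₂, G.Adj x y₁ ∧ G.Adj x y₂ ∧ G.Adj y₁ z₁ ∧ G.Adj y₂ z₂ ∧ y₁ ≠ y₂ ∧ z₁ ≠ z₂ ∧
      z₁ ≠ x ∧ z₂ ≠ x ∧ ¬ G.Adj x z₁ ∧ ¬ G.Adj x z₂ := by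
  rcases hG.exists_path_or_twins hd hcard with ⟨x, y, z, w, hxy, hyz, hzw, hne, hxz, hxw⟩ | h
  · by_cases hyw : G.Adj y w
    · have key : ∃ y' b, G.Adj x y' ∧ y' ≠ y ∧ G.Adj y' b ∧ b ≠ x ∧ ¬ G.Adj x b := by
        by_contra! hcon
        have hyy' : ∀ y', G.Adj x y' → y' ≠ y → G.Adj y y' := by
          intro y' hxy' hne'
          by_contra hn
          obtain ⟨a, ha1, ha2, ha3⟩ := hd.exists_private_neighbor (z := y) hxy'.symm hxy hne'
            (fun h ↦ hn h.symm)
          exact ha3 (hcon y' a hxy' hne' ha1 ha2)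
        have hsub : insert x (insert z ((G.neighborFinset x).erase y)) ⊆ G.neighborFinset y := by
          intro a ha
          have := hyy' a
          have := hxy.symm
          simp only [Finset.mem_insert, Finset.mem_erase, mem_neighborFinset] at *
          grind
        have h1 := Finset.card_le_card hsub
        rw [Finset.card_insert_of_notMem (by simp [hne]),
          Finset.card_insert_of_notMem (by simp [hxz]),
          Finset.card_erase_of_mem (by simpa using hxy), card_neighborFinset_eq_degree,
          card_neighborFinset_eq_degree, hd x, hd y] at h1
        lia
      obtain ⟨y', b, hxy', hne', hb, hbx, hxb⟩ := key
      have hwx : w ≠ x := by rintro rfl; exact hxz hzw.symm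
      by_cases hbz : b = z
      · subst hbz
        exact ⟨x, y, y', w, b, hxy, hxy', hyw, hb, hne'.symm, hzw.ne', hwx, hbx, hxw, hxb⟩
      · exact ⟨x, y, y', z, b, hxy, hxy', hyz, hb, hne'.symm, Ne.symm hbz, hne.symm, hbx, hxz, hxb⟩
    · obtain ⟨a, hxa, hay, hya⟩ := hd.exists_private_neighbor hxy hyz hne hxz
      exact ⟨y, x, z, a, w, hxy.symm, hyz, hxa, hzw, hne, by rintro rfl; exact hxw hxa, hay,
        by rintro rfl; exact hxw hxy, hya, hyw⟩
  · obtain ⟨x⟩ := hG.nonempty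
    obtain ⟨y₁, y₂, hy₁, hy₂, hy⟩ := hd.exists_two_neighbors hd2 x
    obtain ⟨z₁, z₂, hne, h₁, h₂, hz⟩ := h x
    refine ⟨x, y₁, y₂, z₁, z₂, hy₁, hy₂, ((hz y₁).1.2 hy₁).symm, ((hz y₂).2.2 hy₂).symm, hy, hne,
      h₁, h₂, fun h ↦ ?_, fun h ↦ ?_⟩
    · exact G.loopless.irrefl x ((hz x).1.1 h.symm)
    · exact G.loopless.irrefl x ((hz x).2.1 h.symm)

end Host

end SimpleGraph

/-! ### Partial copies with two misses -/

namespace SimpleGraph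

variable {V W : Type*} [DecidableEq V] {T : SimpleGraph V}

omit [DecidableEq V] in
/-- In a subtree, a vertex `a` of the same color as `p` is at distance two from `p`, or the subtree
contains a path of length four that starts at `p`. -/
lemma exists_path_of_color_eq (C : T.Coloring (Fin 2)) {S : Finset V}
    (hS : (T.induce (S : Set V)).Preconnected) {p a : V} (hp : p ∈ S) (ha : a ∈ S) (hpa : a ≠ p)
    (hC : C a = C p) :
    (∃ r ∈ S, T.Adj p r ∧ T.Adj r a) ∨
    ∃ r ∈ S, ∃ s ∈ S, ∃ u ∈ S, ∃ w ∈ S, T.Adj p r ∧ T.Adj r s ∧ T.Adj s u ∧ T.Adj u w ∧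
      [p, r, s, u, w].Nodup := by
  obtain ⟨q, hq⟩ := hS.exists_isPath ⟨p, hp⟩ ⟨a, ha⟩
  have hcol : ∀ x y, T.Adj x y → C x ≠ C y := fun x y h ↦ C.valid h
  rcases q with _ | ⟨h1, _ | ⟨h2, _ | ⟨h3, _ | ⟨h4, q⟩⟩⟩⟩
  · exact (hpa rfl).elim
  · exact (hcol _ _ h1 hC.symm).elim
  · exact .inl ⟨_, Subtype.prop _, h1, h2⟩
  · have hodd : ∀ i j k l : Fin 2, i ≠ j → j ≠ k → k ≠ l → i ≠ l := by decide
    exact (hodd _ _ _ _ (hcol _ _ h1) (hcol _ _ h2) (hcol _ _ h3) hC.symm).elim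
  · refine .inr ⟨_, Subtype.prop _, _, Subtype.prop _, _, Subtype.prop _, _, Subtype.prop _,
      h1, h2, h3, h4, ?_⟩
    have := hq.support_nodup
    rw [Walk.support_cons, Walk.support_cons, Walk.support_cons, Walk.support_cons] at this
    have hm := q.start_mem_support
    grind

namespace PartialCopy

lemma exists_adj_pair {G : SimpleGraph W} (hT : T.IsAcyclic) {v₁ v₂ : V}
    {w₁ w₂ : W} (hv : T.Adj v₁ v₂) (hw : G.Adj w₁ w₂) :
    ∃ φ, PartialCopy T G {v₂, v₁} φ ∧ φ v₁ = w₁ ∧ φ v₂ = w₂ := by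
  obtain ⟨φ, hφ, e, f⟩ := (singleton (T := T) (G := G) (φ := fun _ ↦ w₁) v₁).exists_insert hT
    (u := v₁) (v := v₂) (w := w₂) (by simp) (by simpa using hv.ne') hv (by simpa using hw.ne) hw
  exact ⟨φ, hφ, e _ (by simp), f⟩

lemma exists_path_four {G : SimpleGraph W} (hT : T.IsAcyclic) {v₁ v₂ v₃ v₄ : V}
    {w₁ w₂ w₃ w₄ : W} (hv : [v₁, v₂, v₃, v₄].Nodup) (hw : [w₁, w₂, w₃, w₄].Nodup)
    (h₁ : T.Adj v₁ v₂) (h₂ : T.Adj v₂ v₃) (h₃ : T.Adj v₃ v₄)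
    (g₁ : G.Adj w₁ w₂) (g₂ : G.Adj w₂ w₃) (g₃ : G.Adj w₃ w₄) :
    ∃ φ, PartialCopy T G {v₄, v₃, v₂, v₁} φ ∧ φ v₁ = w₁ ∧ φ v₂ = w₂ ∧ φ v₃ = w₃ ∧ φ v₄ = w₄ := by
  simp only [List.nodup_cons, List.mem_cons, List.not_mem_nil, not_or, or_false] at hv hw
  obtain ⟨φ₁, hφ₁, f₁, f₂⟩ := exists_adj_pair hT h₁ g₁
  obtain ⟨φ₂, hφ₂, e₂, f₃⟩ := hφ₁.exists_insert hT (u := v₂) (v := v₃) (w := w₃) (by simp)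
    (by simp; grind) h₂ (by simp; grind) (by rwa [f₂])
  obtain ⟨φ₃, hφ₃, e₃, f₄⟩ := hφ₂.exists_insert hT (u := v₃) (v := v₄) (w := w₄) (by simp)
    (by simp; grind) h₃ (by simp; grind) (by rwa [f₃])
  refine ⟨φ₃, hφ₃, ?_, ?_, ?_, f₄⟩
  · rw [e₃ _ (by simp), e₂ _ (by simp), f₁]
  · rw [e₃ _ (by simp), e₂ _ (by simp), f₂]
  · rw [e₃ _ (by simp), f₃]

lemma exists_path_five {G : SimpleGraph W} (hT : T.IsAcyclic) {v₁ v₂ v₃ v₄ v₅ : V}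
    {w₁ w₂ w₃ w₄ w₅ : W} (hv : [v₁, v₂, v₃, v₄, v₅].Nodup) (hw : [w₁, w₂, w₃, w₄, w₅].Nodup)
    (h₁ : T.Adj v₁ v₂) (h₂ : T.Adj v₂ v₃) (h₃ : T.Adj v₃ v₄) (h₄ : T.Adj v₄ v₅)
    (g₁ : G.Adj w₁ w₂) (g₂ : G.Adj w₂ w₃) (g₃ : G.Adj w₃ w₄) (g₄ : G.Adj w₄ w₅) :
    ∃ φ, PartialCopy T G {v₅, v₄, v₃, v₂, v₁} φ ∧
      φ v₁ = w₁ ∧ φ v₂ = w₂ ∧ φ v₃ = w₃ ∧ φ v₄ = w₄ ∧ φ v₅ = w₅ := by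
  obtain ⟨φ₁, hφ₁, f₁, f₂, f₃, f₄⟩ := exists_path_four hT (v₁ := v₁) (v₂ := v₂) (v₃ := v₃)
    (v₄ := v₄) (w₁ := w₁) (w₂ := w₂) (w₃ := w₃) (w₄ := w₄) (by grind) (by grind) h₁ h₂ h₃ g₁ g₂ g₃
  simp only [List.nodup_cons, List.mem_cons, List.not_mem_nil, not_or, or_false] at hv hw
  obtain ⟨φ₂, hφ₂, e, f₅⟩ := hφ₁.exists_insert hT (u := v₄) (v := v₅) (w := w₅) (by simp)
    (by simp; grind) h₄ (by simp; grind) (by rwa [f₄])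
  refine ⟨φ₂, hφ₂, ?_, ?_, ?_, ?_, f₅⟩
  · rw [e _ (by simp), f₁]
  · rw [e _ (by simp), f₂]
  · rw [e _ (by simp), f₃]
  · rw [e _ (by simp), f₄]

lemma exists_fork {G : SimpleGraph W} (hT : T.IsAcyclic) {v₁ v₂ v₃ v₄ : V}
    {w₁ w₂ w₃ w₄ : W} (hv : [v₁, v₂, v₃, v₄].Nodup) (hw : [w₁, w₂, w₃, w₄].Nodup)
    (h₁ : T.Adj v₁ v₂) (h₂ : T.Adj v₂ v₃) (h₃ : T.Adj v₂ v₄)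
    (g₁ : G.Adj w₁ w₂) (g₂ : G.Adj w₂ w₃) (g₃ : G.Adj w₂ w₄) :
    ∃ φ, PartialCopy T G {v₄, v₃, v₂, v₁} φ ∧ φ v₁ = w₁ ∧ φ v₂ = w₂ ∧ φ v₃ = w₃ ∧ φ v₄ = w₄ := by
  simp only [List.nodup_cons, List.mem_cons, List.not_mem_nil, not_or, or_false] at hv hw
  obtain ⟨φ₁, hφ₁, f₁, f₂⟩ := exists_adj_pair hT h₁ g₁
  obtain ⟨φ₂, hφ₂, e₂, f₃⟩ := hφ₁.exists_insert hT (u := v₂) (v := v₃) (w := w₃) (by simp)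
    (by simp; grind) h₂ (by simp; grind) (by rwa [f₂])
  have f₂' : φ₂ v₂ = w₂ := by rw [e₂ _ (by simp), f₂]
  obtain ⟨φ₃, hφ₃, e₃, f₄⟩ := hφ₂.exists_insert hT (u := v₂) (v := v₄) (w := w₄) (by simp)
    (by simp; grind) h₃ (by simp; grind) (by rwa [f₂'])
  refine ⟨φ₃, hφ₃, ?_, ?_, ?_, f₄⟩
  · rw [e₃ _ (by simp), e₂ _ (by simp), f₁]
  · rw [e₃ _ (by simp), f₂']
  · rw [e₃ _ (by simp), f₃]

end PartialCopy

variable [Fintype W] [DecidableEq W] {G : SimpleGraph W} [DecidableRel G.Adj] {d : ℕ}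

/-- The seeds of all embeddings of trees on `d + 3` vertices: a subtree with at most `d + 1` vertices in which two further vertices have the color of `p` has
a partial copy in which the image of `p` misses (is not adjacent to) the images of two others. -/
lemma Connected.exists_partialCopy_two_misses (hG : G.Connected) (hd : G.IsRegularOfDegree d)
    (hd3 : 3 ≤ d) (hcard : d + 3 ≤ Fintype.card W) (hT : T.IsAcyclic) (C : T.Coloring (Fin 2))
    {S : Finset V} (hS : (T.induce (S : Set V)).Preconnected) (hSd : S.card ≤ d + 1)
    {p a₁ a₂ : V} (hp : p ∈ S) (h₁ : a₁ ∈ S) (h₂ : a₂ ∈ S) (hp₁ : a₁ ≠ p) (hp₂ : a₂ ≠ p)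
    (h₁₂ : a₁ ≠ a₂) (hC₁ : C a₁ = C p) (hC₂ : C a₂ = C p) :
    ∃ φ, PartialCopy T G S φ ∧ ∃ b₁ ∈ S, ∃ b₂ ∈ S, b₁ ≠ b₂ ∧ b₁ ≠ p ∧ b₂ ≠ p ∧
      ¬ G.Adj (φ p) (φ b₁) ∧ ¬ G.Adj (φ p) (φ b₂) := by
  -- it suffices to find such a partial copy of a smaller subtree
  have seed : ∀ (S₀ : Finset V) (φ₀ : V → W), PartialCopy T G S₀ φ₀ → S₀ ⊆ S → p ∈ S₀ →
      ∀ b₁ ∈ S₀, ∀ b₂ ∈ S₀, b₁ ≠ b₂ → b₁ ≠ p → b₂ ≠ p →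
      ¬ G.Adj (φ₀ p) (φ₀ b₁) → ¬ G.Adj (φ₀ p) (φ₀ b₂) →
      ∃ φ, PartialCopy T G S φ ∧ ∃ b₁ ∈ S, ∃ b₂ ∈ S, b₁ ≠ b₂ ∧ b₁ ≠ p ∧ b₂ ≠ p ∧
        ¬ G.Adj (φ p) (φ b₁) ∧ ¬ G.Adj (φ p) (φ b₂) := by
    intro S₀ φ₀ h₀ hsub hp₀ b₁ hb₁ b₂ hb₂ hne hb₁p hb₂p hn₁ hn₂
    obtain ⟨φ, hφ, heq⟩ := h₀.exists_extend (fun x ↦ (hd x).ge) hT hS hSd ⟨p, hp₀⟩ hsub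
    refine ⟨φ, hφ, b₁, hsub hb₁, b₂, hsub hb₂, hne, hb₁p, hb₂p, ?_, ?_⟩
    · rwa [heq p hp₀, heq b₁ hb₁]
    · rwa [heq p hp₀, heq b₂ hb₂]
  have hcol : ∀ x y, T.Adj x y → C x ≠ C y := fun x y h ↦ C.valid h
  have hsub : ∀ v₁ ∈ S, ∀ v₂ ∈ S, ∀ v₃ ∈ S, ∀ v₄ ∈ S, ∀ v₅ ∈ S,
      ({v₅, v₄, v₃, v₂, v₁} : Finset V) ⊆ S := by
    simp +contextual [Finset.insert_subset_iff]
  have hlong : (∃ r ∈ S, ∃ s ∈ S, ∃ u ∈ S, ∃ w ∈ S, T.Adj p r ∧ T.Adj r s ∧ T.Adj s u ∧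
      T.Adj u w ∧ [p, r, s, u, w].Nodup) →
      ∃ φ, PartialCopy T G S φ ∧ ∃ b₁ ∈ S, ∃ b₂ ∈ S, b₁ ≠ b₂ ∧ b₁ ≠ p ∧ b₂ ≠ p ∧
        ¬ G.Adj (φ p) (φ b₁) ∧ ¬ G.Adj (φ p) (φ b₂) := by
    rintro ⟨r, hr, s, hs, u, hu, w, hw, hpr, hrs, hsu, huw, hnd⟩
    have hnd' := hnd
    simp only [List.nodup_cons, List.mem_cons, List.not_mem_nil, not_or, or_false] at hnd'
    rcases hG.exists_path_or_twins hd hcard with ⟨x, y, z, v, hxy, hyz, hzv, hne, hxz, hxv⟩ | h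
    · have hvx : x ≠ v := by rintro rfl; exact hxz hzv.symm
      have hvy : y ≠ v := by rintro rfl; exact hxv hxy
      obtain ⟨φ, hφ, f₁, f₂, f₃, f₄⟩ := PartialCopy.exists_path_four hT (v₁ := p) (v₂ := r)
        (v₃ := s) (v₄ := u) (w₁ := x) (w₂ := y) (w₃ := z) (w₄ := v) (by simp [hnd'])
        (by simp [hxy.ne, hyz.ne, hzv.ne, hne, hvx, hvy]) hpr hrs hsu hxy hyz hzv
      exact seed _ φ hφ (by simp [Finset.insert_subset_iff, *]) (by simp) s (by simp) u (by simp)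
        hnd'.2.2.1.1 (Ne.symm hnd'.1.2.1) (Ne.symm hnd'.1.2.2.1) (by rwa [f₁, f₃])
        (by rwa [f₁, f₄])
    · obtain ⟨x⟩ := hG.nonempty
      obtain ⟨y₁, y₂, hy₁, hy₂, hy⟩ := hd.exists_two_neighbors (by lia) x
      obtain ⟨z₁, z₂, hne, hz₁, hz₂, hz⟩ := h x
      have hn₁ : ¬ G.Adj x z₁ := fun h ↦ G.loopless.irrefl x ((hz x).1.1 h.symm)
      have hn₂ : ¬ G.Adj x z₂ := fun h ↦ G.loopless.irrefl x ((hz x).2.1 h.symm)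
      have a₁ := (hz y₁).1.2 hy₁
      have a₂ := (hz y₂).1.2 hy₂
      have a₃ := (hz y₂).2.2 hy₂
      have a₄ := (hz y₁).2.2 hy₁
      obtain ⟨φ, hφ, f₁, f₂, f₃, f₄, f₅⟩ := PartialCopy.exists_path_five hT hnd (w₁ := x)
        (w₂ := y₁) (w₃ := z₁) (w₄ := y₂) (w₅ := z₂)
        (by simp [hy₁.ne, hy₂.ne, hne, hy, hz₁.symm, hz₂.symm, a₁.ne', a₂.ne, a₃.ne', a₄.ne'])
        hpr hrs hsu huw hy₁ a₁.symm a₂ a₃.symm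
      exact seed _ φ hφ (hsub _ hp _ hr _ hs _ hu _ hw) (by simp) s (by simp) w (by simp)
        hnd'.2.2.1.2 (Ne.symm hnd'.1.2.1) (Ne.symm hnd'.1.2.2.2) (by rwa [f₁, f₃])
        (by rwa [f₁, f₅])
  rcases exists_path_of_color_eq C hS hp h₁ hp₁ hC₁ with ⟨r₁, hr₁, hpr₁, hra₁⟩ | h
  swap
  · exact hlong h
  rcases exists_path_of_color_eq C hS hp h₂ hp₂ hC₂ with ⟨r₂, hr₂, hpr₂, hra₂⟩ | h
  swap
  · exact hlong h
  by_cases hr : r₁ = r₂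
  · subst hr
    obtain ⟨x, y, z₁, z₂, hxy, hyz₁, hyz₂, hz, hz₁, hz₂, hn₁, hn₂⟩ :=
      hG.exists_adj_two_private hd hd3 hcard
    obtain ⟨φ, hφ, f₁, f₂, f₃, f₄⟩ := PartialCopy.exists_fork hT (v₁ := p) (v₂ := r₁) (v₃ := a₁)
      (v₄ := a₂) (w₁ := x) (w₂ := y) (w₃ := z₁) (w₄ := z₂)
      (by simp [hpr₁.ne, hra₁.ne, hra₂.ne, h₁₂, hp₁.symm, hp₂.symm])
      (by simp [hxy.ne, hyz₁.ne, hyz₂.ne, hz, hz₁.symm, hz₂.symm]) hpr₁ hra₁ hra₂ hxy hyz₁ hyz₂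
    exact seed _ φ hφ (by simp [Finset.insert_subset_iff, *]) (by simp) a₁ (by simp) a₂ (by simp)
      h₁₂ hp₁ hp₂ (by rwa [f₁, f₃]) (by rwa [f₁, f₄])
  · obtain ⟨x, y₁, y₂, z₁, z₂, hxy₁, hxy₂, hyz₁, hyz₂, hy, hz, hz₁, hz₂, hn₁, hn₂⟩ :=
      hG.exists_two_disjoint_exits hd (by lia) hcard
    have hn₃ : z₁ ≠ y₂ := by rintro rfl; exact hn₁ hxy₂
    have hn₄ : y₁ ≠ z₂ := by rintro rfl; exact hn₂ hxy₁
    have hn₅ : a₁ ≠ r₂ := by rintro rfl; exact hcol _ _ hpr₂ hC₁.symm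
    have hn₆ : r₁ ≠ a₂ := by rintro rfl; exact hcol _ _ hpr₁ hC₂.symm
    obtain ⟨φ, hφ, f₁, f₂, f₃, f₄, f₅⟩ := PartialCopy.exists_path_five hT
      (v₁ := a₁) (v₂ := r₁) (v₃ := p) (v₄ := r₂) (v₅ := a₂)
      (w₁ := z₁) (w₂ := y₁) (w₃ := x) (w₄ := y₂) (w₅ := z₂)
      (by simp [hra₁.ne', hpr₁.ne', hpr₂.ne, hra₂.ne, hp₁, hp₂.symm, h₁₂, hn₅, hn₆, hr])
      (by simp [hyz₁.ne', hxy₁.ne', hxy₂.ne, hyz₂.ne, hz₁, hz₂.symm, hz, hn₃, hn₄, hy])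
      hra₁.symm hpr₁.symm hpr₂ hra₂ hyz₁.symm hxy₁.symm hxy₂ hyz₂
    exact seed _ φ hφ (hsub _ h₁ _ hr₁ _ hp _ hr₂ _ h₂) (by simp) a₁ (by simp) a₂ (by simp)
      h₁₂ hp₁ hp₂ (by rwa [f₃, f₁]) (by rwa [f₃, f₅])

end SimpleGraph

/-! ### Trees on `d + 2` vertices, and completing partial copies -/

namespace SimpleGraph

variable {V W : Type*} [DecidableEq V] {T : SimpleGraph V}

omit [DecidableEq V] in
/-- In a tree that is not a star, every vertex starts an induced path on three vertices. -/
lemma IsTree.exists_induced_path_of_not_isStar (hT : T.IsTree) (hstar : ¬ IsStar T) (p : V) :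
    ∃ r s, T.Adj p r ∧ T.Adj r s ∧ s ≠ p ∧ ¬ T.Adj p s := by
  obtain ⟨v, hvp, hpv⟩ : ∃ v, v ≠ p ∧ ¬ T.Adj p v := by
    by_contra! hcon
    refine hstar ⟨p, ?_⟩
    ext x y
    rw [starGraph_adj]
    refine ⟨fun h ↦ ⟨h.ne, ?_⟩, ?_⟩
    · by_contra! hxy
      exact h.ne <| hT.isAcyclic.eq_of_adj_of_preconnected_induce (s := {x, y})
        (induce_pair_connected_of_adj h).preconnected (v := p)
        (by simp [hxy.1.symm, hxy.2.symm]) (by simp) (by simp) (hcon x hxy.1).symm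
        (hcon y hxy.2).symm
    · rintro ⟨hne, rfl | rfl⟩
      · exact hcon y hne.symm
      · exact (hcon x hne).symm
  obtain ⟨w⟩ := hT.connected.preconnected p v
  obtain ⟨e, -, he1, he2⟩ := w.exists_boundary_dart {x | x = p ∨ T.Adj p x} (.inl rfl)
    (by simp [hvp, hpv])
  have hadj := e.adj
  simp only [Set.mem_ofPred_eq, not_or] at he1 he2
  rcases he1 with h | h
  · rw [h] at hadj
    exact (he2.2 hadj).elim
  · exact ⟨_, _, h, hadj, he2.1, he2.2⟩

variable [Fintype W] [DecidableEq W] {G : SimpleGraph W} [DecidableRel G.Adj] {d : ℕ}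

/-- A connected `d`-regular graph that is not complete contains every tree on `d + 2` vertices other
than the star. -/
theorem Connected.isContained_of_not_isStar [Fintype V] (hG : G.Connected)
    (hd : G.IsRegularOfDegree d) (hcard : d + 2 ≤ Fintype.card W) (hT : T.IsTree)
    (hV : Fintype.card V = d + 2) (hstar : ¬ IsStar T) : T.IsContained G := by
  classical
  have : Nontrivial V := Fintype.one_lt_card_iff_nontrivial.1 (by lia)
  obtain ⟨l, hl⟩ := hT.exists_vert_degree_one_of_nontrivial
  obtain ⟨p, hlp, hlu⟩ := degree_eq_one_iff_existsUnique_adj.1 hl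
  obtain ⟨r, s, hpr, hrs, hsp, hps⟩ := hT.exists_induced_path_of_not_isStar hstar p
  obtain ⟨x, y, z, hxy, hyz, hxz, hnxz⟩ := hG.exists_induced_path hd hcard
  have hrl : r ≠ l := by rintro rfl; exact hsp (hlu s hrs)
  have hsl : s ≠ l := by rintro rfl; exact hpr.ne' (hlu r hrs.symm)
  obtain ⟨φ₁, hφ₁, f₁, f₂⟩ := PartialCopy.exists_adj_pair hT.isAcyclic hpr hxy
  obtain ⟨φ₂, hφ₂, e₂, f₃⟩ := hφ₁.exists_insert hT.isAcyclic (u := r) (v := s) (w := z) (by simp)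
    (by simp [hrs.ne', hsp]) hrs (by simp [f₁, f₂, hyz.ne, hxz]) (by rwa [f₂])
  obtain ⟨φ, hφ, e⟩ := hφ₂.exists_extend (fun x ↦ (hd x).ge) hT.isAcyclic
    (S' := Finset.univ.erase l)
    (hT.connected.preconnected.induce_of_degree_eq_one fun v hv ↦ by
      obtain rfl : v = l := by simpa using hv
      exact fun a ha b hb ↦ (hlu a ha).trans (hlu b hb).symm)
    (by rw [Finset.card_erase_of_mem (Finset.mem_univ l), Finset.card_univ]; lia)
    (by simp) (by simp [Finset.subset_erase, hrl.symm, hsl.symm, hlp.ne])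
  have g₁ : φ p = x := by rw [e p (by simp), e₂ p (by simp), f₁]
  have g₃ : φ s = z := by rw [e s (by simp), f₃]
  obtain ⟨w, hw, hw'⟩ := PartialCopy.exists_free (φ := φ) (S := Finset.univ.erase l)
    (fun x ↦ (hd x).ge) (u := p) (by simp [hlp.ne']) {φ s}
    (by
      rw [Finset.singleton_subset_iff]
      exact Finset.mem_image_of_mem φ (by simp [hsl]))
    (by simp [g₁, g₃, hxz]) (by simp [g₁, g₃, hnxz])
    (by rw [Finset.card_erase_of_mem (Finset.mem_univ l), Finset.card_univ]; simp; lia)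
  have := hφ.insert hT.isAcyclic (v := l) (by simp [hlp.ne']) (by simp) hlp.symm hw' hw
  rw [Finset.insert_erase (Finset.mem_univ l)] at this
  exact this.isContained

namespace PartialCopy

variable {S : Finset V} {φ : V → W}

/-- A partial copy of all of `T` but a leaf at `p` can be completed when the image of `p` misses the
images of two other vertices. -/
lemma isContained_of_two_misses [Fintype V] (h : PartialCopy T G S φ)
    (hd : G.IsRegularOfDegree d) (hT : T.IsAcyclic) {l p b₁ b₂ : V} (hl : l ∉ S)
    (huniv : Insert.insert l S = Finset.univ) (hcard : S.card ≤ d + 2) (hp : p ∈ S) (hlp : T.Adj l p)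
    (hb₁ : b₁ ∈ S) (hb₂ : b₂ ∈ S) (hb : b₁ ≠ b₂) (hbp₁ : b₁ ≠ p) (hbp₂ : b₂ ≠ p)
    (hn₁ : ¬ G.Adj (φ p) (φ b₁)) (hn₂ : ¬ G.Adj (φ p) (φ b₂)) : T.IsContained G := by
  obtain ⟨w, hw, hw'⟩ := exists_free (φ := φ) (fun x ↦ (hd x).ge) hp {φ b₁, φ b₂}
    (by
      rw [Finset.insert_subset_iff, Finset.singleton_subset_iff]
      exact ⟨Finset.mem_image_of_mem φ hb₁, Finset.mem_image_of_mem φ hb₂⟩)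
    (by
      have h₁ : φ p ≠ φ b₁ := fun e ↦ hbp₁ (h.inj hp hb₁ e).symm
      have h₂ : φ p ≠ φ b₂ := fun e ↦ hbp₂ (h.inj hp hb₂ e).symm
      simp [h₁, h₂])
    (by simp [hn₁, hn₂])
    (by rwa [Finset.card_pair fun e ↦ hb (h.inj hb₁ hb₂ e)])
  have := h.insert hT hp hl hlp.symm hw' hw
  rw [huniv] at this
  exact this.isContained

/-- A partial copy of all of `T` but two leaves, at `p` and at `q`, can be completed when the image
of `p` misses the images of two other vertices and that of `q` misses the image of one. -/
lemma isContained_of_three_misses [Fintype V] {l m p q b₁ b₂ c : V}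
    (h : PartialCopy T G (Finset.univ \ {l, m}) φ) (hd : G.IsRegularOfDegree d)
    (hT : T.IsAcyclic) (hV : Fintype.card V = d + 3) (hlm : l ≠ m)
    (hp : p ∈ Finset.univ \ {l, m}) (hq : q ∈ Finset.univ \ {l, m})
    (hlp : T.Adj l p) (hmq : T.Adj m q) (hb₁ : b₁ ∈ Finset.univ \ {l, m})
    (hb₂ : b₂ ∈ Finset.univ \ {l, m}) (hb : b₁ ≠ b₂) (hbp₁ : b₁ ≠ p) (hbp₂ : b₂ ≠ p)
    (hn₁ : ¬ G.Adj (φ p) (φ b₁)) (hn₂ : ¬ G.Adj (φ p) (φ b₂))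
    (hc : c ∈ Finset.univ \ {l, m}) (hcq : c ≠ q) (hnc : ¬ G.Adj (φ q) (φ c)) :
    T.IsContained G := by
  have hScard : (Finset.univ \ {l, m} : Finset V).card = d + 1 := by
    rw [Finset.card_sdiff_of_subset (Finset.subset_univ _), Finset.card_pair hlm,
      Finset.card_univ]
    lia
  have hm : m ∉ Finset.univ \ {l, m} := by simp
  obtain ⟨w, hw, hw'⟩ := exists_free (φ := φ) (fun x ↦ (hd x).ge) hq {φ c}
    (by
      rw [Finset.singleton_subset_iff]
      exact Finset.mem_image_of_mem φ hc)
    (by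
      have h₁ : φ q ≠ φ c := fun e ↦ hcq (h.inj hq hc e).symm
      simp [h₁])
    (by simp [hnc]) (by rw [hScard]; simp)
  obtain ⟨ψ, hψ, e, -⟩ := h.exists_insert hT hq hm hmq.symm hw' hw
  exact hψ.isContained_of_two_misses hd hT (l := l) (p := p) (b₁ := b₁) (b₂ := b₂)
    (by simp [hlm]) (by ext x; simp; tauto) (by rw [Finset.card_insert_of_notMem hm]; lia)
    (Finset.mem_insert_of_mem hp) hlp (Finset.mem_insert_of_mem hb₁) (Finset.mem_insert_of_mem hb₂)
    hb hbp₁ hbp₂ (by rwa [e p hp, e b₁ hb₁]) (by rwa [e p hp, e b₂ hb₂])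

omit [Fintype W] [DecidableEq W] [DecidableRel G.Adj] in
/-- If the image of `q` is adjacent to the images of all other vertices, and `q` is a leaf of the
subtree with neighbor `q'`, then the images of `q` and of `v` can be exchanged whenever `v = q'` or
the images of `v` and `q'` are adjacent. -/
lemma swap (h : PartialCopy T G S φ) {q q' v : V} (hq : q ∈ S) (hv : v ∈ S) (hvq : v ≠ q)
    (hq' : ∀ x ∈ S, T.Adj q x → x = q') (huniv : ∀ c ∈ S, c ≠ q → G.Adj (φ q) (φ c))
    (hv' : v = q' ∨ G.Adj (φ v) (φ q')) : PartialCopy T G S (φ ∘ Equiv.swap q v) where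
  conn := h.conn
  inj := by
    have hmaps : ∀ a ∈ S, Equiv.swap q v a ∈ S := by
      intro a ha
      rw [Equiv.swap_apply_def]
      split_ifs <;> assumption
    exact fun a ha b hb hab ↦ (Equiv.swap q v).injective (h.inj (hmaps a ha) (hmaps b hb) hab)
  adj := by
    -- the edges that the exchange affects, oriented so that `a` is the exchanged end
    have key : ∀ a ∈ S, ∀ b ∈ S, T.Adj a b → a = q ∨ (b ≠ q ∧ a = v) →
        G.Adj (φ (Equiv.swap q v a)) (φ (Equiv.swap q v b)) := by
      rintro a ha b hb hab (rfl | ⟨hbq, rfl⟩)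
      · obtain rfl := hq' b hb hab
        rw [Equiv.swap_apply_left]
        by_cases hvb : v = b
        · subst hvb
          rw [Equiv.swap_apply_right]
          exact (huniv v hv hvq).symm
        · rw [Equiv.swap_apply_of_ne_of_ne hab.ne' (Ne.symm hvb)]
          exact hv'.resolve_left hvb
      · rw [Equiv.swap_apply_right, Equiv.swap_apply_of_ne_of_ne hbq hab.ne']
        exact huniv b hb hbq
    intro a ha b hb hab
    by_cases h1 : a = q ∨ (b ≠ q ∧ a = v)
    · exact key a ha b hb hab h1
    by_cases h2 : b = q ∨ (a ≠ q ∧ b = v)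
    · exact (key b hb a ha hab.symm h2).symm
    have ha' : a ≠ q ∧ a ≠ v := by grind
    have hb' : b ≠ q ∧ b ≠ v := by grind
    simp only [Function.comp_apply, Equiv.swap_apply_of_ne_of_ne ha'.1 ha'.2,
      Equiv.swap_apply_of_ne_of_ne hb'.1 hb'.2]
    exact h.adj ha hb hab

end PartialCopy

/-- A pendant path of length two: `l` is a leaf, and its neighbor `p` has exactly one further
neighbor `p'`. -/
structure IsPendantPath (T : SimpleGraph V) (l p p' : V) : Prop where
  adj_leaf : T.Adj l p
  adj : T.Adj p p'
  ne : l ≠ p'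
  eq_of_adj_leaf : ∀ x, T.Adj l x → x = p
  eq_of_adj : ∀ x, T.Adj p x → x = l ∨ x = p'

/-- A tree on at least five vertices that is not a star and in which no vertex is adjacent to two
leaves has two pendant paths of length two. -/
lemma IsTree.exists_two_isPendantPath [Fintype V] (hT : T.IsTree) (hstar : ¬ IsStar T)
    (hV : 5 ≤ Fintype.card V)
    (hleaf : ∀ p l l', T.Adj p l → T.Adj p l' → (T.neighborSet l).Subsingleton →
      (T.neighborSet l').Subsingleton → l = l') :
    ∃ l p p' m q q', IsPendantPath T l p p' ∧ IsPendantPath T m q q' ∧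
      p ≠ q ∧ p' ≠ q ∧ q' ≠ p := by
  classical
  -- the tree that remains when all leaves are removed
  set K : Set V := {v | ¬ (T.neighborSet v).Subsingleton} with hK
  have hKc : (T.induce K).Preconnected :=
    hT.connected.preconnected.induce_of_degree_eq_one fun v hv ↦ by simpa [hK] using hv
  have mem_K : ∀ {v a b}, T.Adj v a → T.Adj v b → a ≠ b → v ∈ K := fun ha hb hab h ↦ hab (h ha hb)
  have hnt : Nontrivial K := by
    obtain ⟨c⟩ := hT.connected.nonempty
    obtain ⟨r, s, hcr, hrs, hsc, hncs⟩ := hT.exists_induced_path_of_not_isStar hstar c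
    have hr : r ∈ K := mem_K hrs hcr.symm hsc
    obtain ⟨r', s', hcr', hrs', hsc', hncs'⟩ := hT.exists_induced_path_of_not_isStar hstar r
    exact ⟨⟨r, hr⟩, ⟨r', mem_K hrs' hcr'.symm hsc'⟩, fun h ↦ hcr'.ne (congrArg Subtype.val h)⟩
  have hKt : (T.induce K).IsTree :=
    ⟨(connected_iff _).2 ⟨hKc, inferInstance⟩, hT.isAcyclic.induce K⟩
  have pend : ∀ p : K, (T.induce K).degree p = 1 →
      ∃ l, ∃ p' : K, IsPendantPath T l p p' := by
    intro p hp
    obtain ⟨p', hpp', hu⟩ := degree_eq_one_iff_existsUnique_adj.1 hp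
    have hu' : ∀ x ∈ K, T.Adj p x → x = p' := fun x hx h ↦
      congrArg Subtype.val (hu ⟨x, hx⟩ h)
    obtain ⟨l, hl, hlp'⟩ : ∃ l, T.Adj p l ∧ l ≠ p' := by
      by_contra! hcon
      exact p.2 fun a ha b hb ↦ (hcon a ha).trans (hcon b hb).symm
    have hlK : l ∉ K := fun h ↦ hlp' (hu' l h hl)
    have hls : (T.neighborSet l).Subsingleton := by simpa [hK] using hlK
    refine ⟨l, p', hl.symm, hpp', hlp', fun x hx ↦ hls hx hl.symm, fun x hx ↦ ?_⟩
    by_cases hxK : x ∈ K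
    · exact .inr (hu' x hxK hx)
    · exact .inl (hleaf p x l hx hl (by simpa [hK] using hxK) hls)
  obtain ⟨p, q, hpq, hp, hq⟩ := hKt.exists_ne_and_degree_eq_one
  obtain ⟨l, p', hP⟩ := pend p hp
  obtain ⟨m, q', hQ⟩ := pend q hq
  have hpq' : (p : V) ≠ q := fun h ↦ hpq (Subtype.ext h)
  -- otherwise the vertices `l`, `p`, `q` and `m` would make up the whole tree
  have hno : ¬ T.Adj p q := by
    intro hadj
    have hqp' : (q : V) = p' := by
      rcases hP.eq_of_adj q hadj with h | h
      · exact (hQ.ne ((hP.eq_of_adj_leaf _ (h ▸ hQ.adj_leaf.symm)).trans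
          (hP.eq_of_adj_leaf _ (h ▸ hQ.adj)).symm)).elim
      · exact h
    have hpq'' : (p : V) = q' := by
      rcases hQ.eq_of_adj p hadj.symm with h | h
      · exact (hP.ne ((hQ.eq_of_adj_leaf _ (h ▸ hP.adj_leaf.symm)).trans
          (hQ.eq_of_adj_leaf _ (h ▸ hP.adj)).symm)).elim
      · exact h
    obtain ⟨a, ha, b, hb, hab⟩ := hT.connected.exists_adj_of_card_lt
      (C := {l, (p : V), (q : V), m}) (by simp)
      (lt_of_le_of_lt Finset.card_le_four (by lia))
    simp only [Finset.mem_insert, Finset.mem_singleton, not_or] at ha hb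
    rcases ha with rfl | rfl | rfl | rfl
    · exact hb.2.1 (hP.eq_of_adj_leaf b hab)
    · rcases hP.eq_of_adj b hab with h | h
      · exact hb.1 h
      · exact hb.2.2.1 (h.trans hqp'.symm)
    · rcases hQ.eq_of_adj b hab with h | h
      · exact hb.2.2.2 h
      · exact hb.2.1 (h.trans hpq''.symm)
    · exact hb.2.2.1 (hQ.eq_of_adj_leaf b hab)
  exact ⟨l, p, p', m, q, q', hP, hQ, hpq', fun h ↦ hno (h ▸ hP.adj), fun h ↦ hno (h ▸ hQ.adj).symm⟩

end SimpleGraph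

/-! ### Trees on `d + 3` vertices -/

namespace SimpleGraph

variable {V W : Type*} [DecidableEq V] {T : SimpleGraph V} [Fintype V]
  [Fintype W] [DecidableEq W] {G : SimpleGraph W} [DecidableRel G.Adj] {d : ℕ}

lemma Connected.preconnected_induce_sdiff_pair (hT : T.Connected) {l m : V}
    (hl : (T.neighborSet l).Subsingleton) (hm : (T.neighborSet m).Subsingleton) :
    (T.induce ((Finset.univ \ {l, m} : Finset V) : Set V)).Preconnected :=
  hT.preconnected.induce_of_degree_eq_one fun v hv ↦ by
    have : v = l ∨ v = m := by
      by_contra hcon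
      exact hv (by simpa using hcon)
    rcases this with rfl | rfl <;> assumption

/-- The case of a tree in which some vertex `p` is adjacent to two leaves. -/
lemma Connected.isContained_of_two_leaves (hG : G.Connected) (hd : G.IsRegularOfDegree d)
    (hd3 : 3 ≤ d) (hcard : d + 3 ≤ Fintype.card W) (hT : T.IsTree)
    (hV : Fintype.card V = d + 3) (C : T.Coloring (Fin 2)) {l l' p : V} (hl : T.Adj p l)
    (hl' : T.Adj p l') (hls : (T.neighborSet l).Subsingleton)
    (hls' : (T.neighborSet l').Subsingleton) (hne : l ≠ l')
    (hC : 3 ≤ (Finset.univ.filter fun v ↦ C v = C p).card) : T.IsContained G := by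
  have hc : 1 < ((Finset.univ.filter fun v ↦ C v = C p).erase p).card := by
    rw [Finset.card_erase_of_mem (by simp)]; lia
  obtain ⟨a₁, ha₁, a₂, ha₂, ha⟩ := Finset.one_lt_card.1 hc
  simp only [Finset.mem_erase, Finset.mem_filter, Finset.mem_univ, true_and] at ha₁ ha₂
  have hCl : C p ≠ C l := C.valid hl
  have hCl' : C p ≠ C l' := C.valid hl'
  have hmem : ∀ v, C v = C p → v ∈ Finset.univ \ {l, l'} := by
    intro v hv
    simp only [Finset.mem_sdiff, Finset.mem_univ, Finset.mem_insert, Finset.mem_singleton,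
      true_and, not_or]
    exact ⟨by rintro rfl; exact hCl hv.symm, by rintro rfl; exact hCl' hv.symm⟩
  have hScard : (Finset.univ \ {l, l'} : Finset V).card ≤ d + 1 := by
    rw [Finset.card_sdiff_of_subset (Finset.subset_univ _), Finset.card_pair hne,
      Finset.card_univ]
    lia
  obtain ⟨φ, hφ, b₁, hb₁, b₂, hb₂, hb, hbp₁, hbp₂, hn₁, hn₂⟩ :=
    hG.exists_partialCopy_two_misses hd hd3 hcard hT.isAcyclic C
      (hT.connected.preconnected_induce_sdiff_pair hls hls') hScard (hmem p rfl) (hmem a₁ ha₁.2)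
      (hmem a₂ ha₂.2) ha₁.1 ha₂.1 ha ha₁.2 ha₂.2
  exact hφ.isContained_of_three_misses hd hT.isAcyclic hV hne (hmem p rfl) (hmem p rfl) hl.symm
    hl'.symm hb₁ hb₂ hb hbp₁ hbp₂ hn₁ hn₂ hb₁ hbp₁ hn₁

omit [DecidableEq V] [Fintype V] in
lemma IsPendantPath.subsingleton_neighborSet {l p p' : V} (h : IsPendantPath T l p p') :
    (T.neighborSet l).Subsingleton :=
  fun a ha b hb ↦ (h.eq_of_adj_leaf a ha).trans (h.eq_of_adj_leaf b hb).symm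

omit [DecidableEq V] [Fintype V] in
lemma IsPendantPath.ne_of_ne {l p p' m q q' : V} (h : IsPendantPath T l p p')
    (h' : IsPendantPath T m q q') (hpq : p ≠ q) : l ≠ m ∧ l ≠ q ∧ m ≠ p := by
  refine ⟨?_, ?_, ?_⟩
  · rintro rfl
    exact hpq (h'.eq_of_adj_leaf p h.adj_leaf)
  · rintro rfl
    exact h'.ne ((h.eq_of_adj_leaf _ h'.adj_leaf.symm).trans (h.eq_of_adj_leaf _ h'.adj).symm)
  · rintro rfl
    exact h.ne ((h'.eq_of_adj_leaf _ h.adj_leaf.symm).trans (h'.eq_of_adj_leaf _ h.adj).symm)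

/-- The case of a tree with two pendant paths of length two, if the color class of the middle vertex
`p` of one of them contains two further vertices besides the end `m` of the other. -/
lemma Connected.isContained_of_two_isPendantPath (hG : G.Connected) (hd : G.IsRegularOfDegree d)
    (hd3 : 3 ≤ d) (hcard : d + 3 ≤ Fintype.card W) (hT : T.IsTree)
    (hV : Fintype.card V = d + 3) (C : T.Coloring (Fin 2)) {l p p' m q q' : V}
    (hP : IsPendantPath T l p p') (hQ : IsPendantPath T m q q') (hpq : p ≠ q) (hq'p : q' ≠ p)
    (hC : 1 < (((Finset.univ.filter fun v ↦ C v = C p).erase p).erase m).card) :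
    T.IsContained G := by
  obtain ⟨a₁, ha₁, a₂, ha₂, ha⟩ := Finset.one_lt_card.1 hC
  simp only [Finset.mem_erase, Finset.mem_filter, Finset.mem_univ, true_and] at ha₁ ha₂
  have hCl : C l ≠ C p := C.valid hP.adj_leaf
  obtain ⟨hlm, hlq, hmp⟩ := hP.ne_of_ne hQ hpq
  have hmem : ∀ v, v ≠ l → v ≠ m → v ∈ Finset.univ \ {l, m} := by
    intro v h₁ h₂
    simp [h₁, h₂]
  have hp := hmem p hP.adj_leaf.ne' hmp.symm
  have hq := hmem q hlq.symm hQ.adj_leaf.ne'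
  have hScard : (Finset.univ \ {l, m} : Finset V).card ≤ d + 1 := by
    rw [Finset.card_sdiff_of_subset (Finset.subset_univ _), Finset.card_pair hlm,
      Finset.card_univ]
    lia
  obtain ⟨φ, hφ, b₁, hb₁, b₂, hb₂, hb, hbp₁, hbp₂, hn₁, hn₂⟩ :=
    hG.exists_partialCopy_two_misses hd hd3 hcard hT.isAcyclic C
      (hT.connected.preconnected_induce_sdiff_pair hP.subsingleton_neighborSet
        hQ.subsingleton_neighborSet) hScard hp
      (hmem a₁ (by rintro rfl; exact hCl ha₁.2.2) ha₁.1)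
      (hmem a₂ (by rintro rfl; exact hCl ha₂.2.2) ha₂.1)
      ha₁.2.1 ha₂.2.1 ha ha₁.2.2 ha₂.2.2
  by_cases hmiss : ∃ c ∈ Finset.univ \ {l, m}, c ≠ q ∧ ¬ G.Adj (φ q) (φ c)
  · obtain ⟨c, hc, hcq, hnc⟩ := hmiss
    exact hφ.isContained_of_three_misses hd hT.isAcyclic hV hlm hp hq hP.adj_leaf hQ.adj_leaf
      hb₁ hb₂ hb hbp₁ hbp₂ hn₁ hn₂ hc hcq hnc
  push Not at hmiss
  have hbq₁ : b₁ ≠ q := by rintro rfl; exact hn₁ (hmiss p hp hpq).symm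
  have hbq₂ : b₂ ≠ q := by rintro rfl; exact hn₂ (hmiss p hp hpq).symm
  have hq'l : q' ≠ l := by
    rintro rfl
    exact hpq (hP.eq_of_adj_leaf q hQ.adj.symm).symm
  have hq' := hmem q' hq'l hQ.ne.symm
  -- the image of `q` is adjacent to all others, so it can be exchanged with that of a vertex `v`
  -- whose image misses something
  obtain ⟨v, hv, hvq, hvp, hv', c, hc, hcv, hcq, hnc⟩ : ∃ v ∈ Finset.univ \ {l, m},
      v ≠ q ∧ v ≠ p ∧ (v = q' ∨ G.Adj (φ v) (φ q')) ∧
      ∃ c ∈ Finset.univ \ {l, m}, c ≠ v ∧ c ≠ q ∧ ¬ G.Adj (φ v) (φ c) := by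
    have key : ∀ b ∈ Finset.univ \ {l, m}, b ≠ p → b ≠ q → b ≠ q' → ¬ G.Adj (φ p) (φ b) →
        ∃ v ∈ Finset.univ \ {l, m}, v ≠ q ∧ v ≠ p ∧ (v = q' ∨ G.Adj (φ v) (φ q')) ∧
        ∃ c ∈ Finset.univ \ {l, m}, c ≠ v ∧ c ≠ q ∧ ¬ G.Adj (φ v) (φ c) := by
      intro b hbS hbp hbq hbq' hn
      by_cases hadj : G.Adj (φ b) (φ q')
      · exact ⟨b, hbS, hbq, hbp, .inr hadj, p, hp, hbp.symm, hpq, fun h ↦ hn h.symm⟩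
      · exact ⟨q', hq', hQ.adj.ne', hq'p, .inl rfl, b, hbS, hbq', hbq, fun h ↦ hadj h.symm⟩
    by_cases hbq' : b₁ = q'
    · exact key b₂ hb₂ hbp₂ hbq₂ (fun h ↦ hb (hbq'.trans h.symm)) hn₂
    · exact key b₁ hb₁ hbp₁ hbq₁ hbq' hn₁
  have hψ := hφ.swap hq hv hvq (q' := q')
    (fun x hx h ↦ (hQ.eq_of_adj x h).resolve_left (by rintro rfl; simp at hx)) hmiss hv'
  have hsp : Equiv.swap q v p = p := Equiv.swap_apply_of_ne_of_ne hpq hvp.symm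
  have hswap : ∀ b ∈ Finset.univ \ {l, m}, Equiv.swap q v b ∈ Finset.univ \ {l, m} := by
    intro b hbS
    rw [Equiv.swap_apply_def]
    split_ifs <;> assumption
  have hswap' : ∀ b, b ≠ p → Equiv.swap q v b ≠ p := by
    intro b hbp h
    exact hbp ((Equiv.swap q v).injective (h.trans hsp.symm))
  exact hψ.isContained_of_three_misses hd hT.isAcyclic hV hlm hp hq hP.adj_leaf hQ.adj_leaf
    (hswap b₁ hb₁) (hswap b₂ hb₂) ((Equiv.swap q v).injective.ne hb) (hswap' b₁ hbp₁)
    (hswap' b₂ hbp₂) (by simpa [hsp] using hn₁) (by simpa [hsp] using hn₂) hc hcq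
    (by simpa [Equiv.swap_apply_of_ne_of_ne hcq hcv] using hnc)

/-- The path on six vertices `l p p' q' q m` is contained in every connected cubic graph on at least
six vertices. Here the color class of `p` is `{p, q', m}`, with only one vertex besides `p` and `m`,
so the copy is given explicitly. -/
lemma Connected.isContained_of_path_six (hG : G.Connected) (hd : G.IsRegularOfDegree d)
    (hcard : d + 3 ≤ Fintype.card W) (hT : T.IsTree)
    (hV : Fintype.card V = d + 3) (hV6 : Fintype.card V = 6) {l p p' m q q' : V}
    (hP : IsPendantPath T l p p') (hQ : IsPendantPath T m q q') (hpq : p ≠ q) (hp'q : p' ≠ q)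
    (hq'p : q' ≠ p) (hp'q' : T.Adj p' q') : T.IsContained G := by
  obtain ⟨hlm, hlq, hmp⟩ := hP.ne_of_ne hQ hpq
  have hp'm : p' ≠ m := by
    rintro rfl
    exact hpq (hQ.eq_of_adj_leaf p hP.adj.symm)
  have hq'l : q' ≠ l := by
    rintro rfl
    exact hpq (hP.eq_of_adj_leaf q hQ.adj.symm).symm
  have hScard : (Finset.univ \ {l, m} : Finset V).card = 4 := by
    rw [Finset.card_sdiff_of_subset (Finset.subset_univ _), Finset.card_pair hlm,
      Finset.card_univ]
    lia
  have n₁ := hP.adj.ne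
  have n₂ := hQ.adj.ne
  have n₃ := hp'q'.ne
  have n₄ := hP.adj_leaf.ne
  have n₅ := hQ.adj_leaf.ne
  have n₆ := hP.ne
  have n₇ := hQ.ne
  have hset : ({q, q', p', p} : Finset V) = Finset.univ \ {l, m} := by
    refine Finset.eq_of_subset_of_card_le ?_ ?_
    · simp only [Finset.insert_subset_iff, Finset.singleton_subset_iff, Finset.mem_sdiff,
        Finset.mem_univ, Finset.mem_insert, Finset.mem_singleton, true_and, not_or]
      grind
    · rw [hScard, Finset.card_insert_of_notMem (by simp; grind),
        Finset.card_insert_of_notMem (by simp; grind),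
        Finset.card_insert_of_notMem (by simp; grind), Finset.card_singleton]
  rcases hG.exists_path_or_twins hd hcard with ⟨x, y, z, w, hxy, hyz, hzw, hne, hxz, hxw⟩ | h
  · have hwx : x ≠ w := by rintro rfl; exact hxz hzw.symm
    have hwy : y ≠ w := by rintro rfl; exact hxw hxy
    obtain ⟨φ, hφ, f₁, f₂, f₃, f₄⟩ := PartialCopy.exists_path_four hT.isAcyclic (v₁ := p)
      (v₂ := p') (v₃ := q') (v₄ := q) (w₁ := x) (w₂ := y) (w₃ := z) (w₄ := w) (by simp; grind)
      (by simp [hxy.ne, hyz.ne, hzw.ne, hne, hwx, hwy]) hP.adj hp'q' hQ.adj.symm hxy hyz hzw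
    rw [hset] at hφ
    exact hφ.isContained_of_three_misses hd hT.isAcyclic hV hlm (p := p) (q := q) (b₁ := q')
      (b₂ := q) (c := p) (by simp [← hset]) (by simp [← hset]) hP.adj_leaf hQ.adj_leaf
      (by simp [← hset]) (by simp [← hset]) n₂.symm hq'p hpq.symm (by rwa [f₁, f₃])
      (by rwa [f₁, f₄]) (by simp [← hset]) hpq (by rw [f₄, f₁]; exact fun h ↦ hxw h.symm)
  · obtain ⟨x⟩ := hG.nonempty
    obtain ⟨y₁, y₂, hy₁, hy₂, hy⟩ := hd.exists_two_neighbors (by lia) x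
    obtain ⟨z₁, z₂, hne, hz₁, hz₂, hz⟩ := h x
    have hn₁ : ¬ G.Adj x z₁ := fun h ↦ G.loopless.irrefl x ((hz x).1.1 h.symm)
    have hn₂ : ¬ G.Adj x z₂ := fun h ↦ G.loopless.irrefl x ((hz x).2.1 h.symm)
    have a₁ := (hz y₁).1.2 hy₁
    have a₂ := (hz y₂).1.2 hy₂
    have a₃ := (hz y₂).2.2 hy₂
    have a₄ := (hz y₁).2.2 hy₁
    obtain ⟨φ, hφ, f₁, f₂, f₃, f₄, f₅⟩ := PartialCopy.exists_path_five hT.isAcyclic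
      (v₁ := p) (v₂ := p') (v₃ := q') (v₄ := q) (v₅ := m) (w₁ := x)
      (w₂ := y₁) (w₃ := z₁) (w₄ := y₂) (w₅ := z₂) (by simp; grind)
      (by simp [hy₁.ne, hy₂.ne, hne, hy, hz₁.symm, hz₂.symm, a₁.ne', a₂.ne, a₃.ne', a₄.ne'])
      hP.adj hp'q' hQ.adj.symm hQ.adj_leaf.symm hy₁ a₁.symm a₂ a₃.symm
    have hml : Insert.insert l (Insert.insert m (Finset.univ \ {l, m})) = Finset.univ := by
      ext v
      simp
      tauto
    rw [hset] at hφ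
    exact hφ.isContained_of_two_misses hd hT.isAcyclic (l := l) (p := p) (b₁ := q') (b₂ := m)
      (by simp [hlm]) hml (by rw [Finset.card_insert_of_notMem (by simp)]; lia)
      (by simp [← hset]) hP.adj_leaf (by simp [← hset]) (by simp) n₇.symm hq'p hmp
      (by rwa [f₁, f₃]) (by rwa [f₁, f₅])

/-- A connected `d`-regular graph on at least `d + 3` vertices contains every tree on `d + 3`
vertices both of whose color classes have at least three vertices. -/
theorem Connected.isContained_of_three_le_colorClass (hG : G.Connected)
    (hd : G.IsRegularOfDegree d) (hcard : d + 3 ≤ Fintype.card W) (hT : T.IsTree)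
    (hV : Fintype.card V = d + 3) (hstar : ¬ IsStar T) (C : T.Coloring (Fin 2))
    (hC : ∀ i, 3 ≤ (Finset.univ.filter fun v ↦ C v = i).card) : T.IsContained G := by
  have hsum : ∀ i j : Fin 2, i ≠ j → (Finset.univ.filter fun v ↦ C v = i).card +
      (Finset.univ.filter fun v ↦ C v = j).card = d + 3 := by
    intro i j hij
    rw [← hV, ← Finset.card_univ, ← Finset.card_union_of_disjoint]
    · congr 1
      ext v
      simp only [Finset.mem_union, Finset.mem_filter, Finset.mem_univ, true_and, iff_true]
      lia
    · rw [Finset.disjoint_filter]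
      exact fun v _ h h' ↦ hij (h.symm.trans h')
  have hd3 : 3 ≤ d := by
    have := hsum 0 1 (by decide)
    have := hC 0
    have := hC 1
    lia
  by_cases hleaf : ∃ p l l', T.Adj p l ∧ T.Adj p l' ∧ (T.neighborSet l).Subsingleton ∧
      (T.neighborSet l').Subsingleton ∧ l ≠ l'
  · obtain ⟨p, l, l', hl, hl', hls, hls', hne⟩ := hleaf
    exact hG.isContained_of_two_leaves hd hd3 hcard hT hV C hl hl' hls hls' hne (hC _)
  push Not at hleaf
  obtain ⟨l, p, p', m, q, q', hP, hQ, hpq, hp'q, hq'p⟩ :=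
    hT.exists_two_isPendantPath hstar (by lia) hleaf
  have hCp : C l ≠ C p := C.valid hP.adj_leaf
  have hCq : C m ≠ C q := C.valid hQ.adj_leaf
  have hcls : ∀ (p m : V), 4 ≤ (Finset.univ.filter fun v ↦ C v = C p).card →
      1 < (((Finset.univ.filter fun v ↦ C v = C p).erase p).erase m).card := by
    intro p m h
    have h₁ := Finset.pred_card_le_card_erase (s := Finset.univ.filter fun v ↦ C v = C p) (a := p)
    have h₂ := Finset.pred_card_le_card_erase
      (s := (Finset.univ.filter fun v ↦ C v = C p).erase p) (a := m)
    lia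
  by_cases hCpq : C p = C q
  · refine hG.isContained_of_two_isPendantPath hd hd3 hcard hT hV C hP hQ hpq hq'p ?_
    rw [Finset.erase_eq_of_notMem (a := m) (by simp [hCpq, hCq]),
      Finset.card_erase_of_mem (by simp)]
    have := hC (C p)
    lia
  by_cases hp4 : 4 ≤ (Finset.univ.filter fun v ↦ C v = C p).card
  · exact hG.isContained_of_two_isPendantPath hd hd3 hcard hT hV C hP hQ hpq hq'p (hcls p m hp4)
  by_cases hq4 : 4 ≤ (Finset.univ.filter fun v ↦ C v = C q).card
  · exact hG.isContained_of_two_isPendantPath hd hd3 hcard hT hV C hQ hP hpq.symm hp'q (hcls q l hq4)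
  -- both classes have three vertices, so that the tree is a path
  have h6 : Fintype.card V = 6 := by
    have := hsum _ _ hCpq
    have := hC (C p)
    have := hC (C q)
    lia
  obtain ⟨hlm, hlq, hmp⟩ := hP.ne_of_ne hQ hpq
  have hq'l : q' ≠ l := by
    rintro rfl
    exact hpq (hP.eq_of_adj_leaf q hQ.adj.symm).symm
  have hCq' : C q ≠ C q' := C.valid hQ.adj
  refine hG.isContained_of_path_six hd hcard hT hV h6 hP hQ hpq hp'q hq'p ?_
  rcases exists_path_of_color_eq C (hT.connected.preconnected_induce_sdiff_pair
      hP.subsingleton_neighborSet hQ.subsingleton_neighborSet) (p := p) (a := q')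
      (by simp [hP.adj_leaf.ne', hmp.symm]) (by simp [hq'l, hQ.ne.symm]) hq'p (by lia) with
    ⟨r, hr, hpr, hrq'⟩ | ⟨r, hr, s, hs, u, hu, w, hw, -, -, -, -, hnd⟩
  · rcases hP.eq_of_adj r hpr with rfl | rfl
    · simp at hr
    · exact hrq'
  · have h₁ : ([p, r, s, u, w].toFinset).card ≤ (Finset.univ \ {l, m} : Finset V).card := by
      refine Finset.card_le_card ?_
      intro v hv
      simp only [List.mem_toFinset, List.mem_cons, List.not_mem_nil, or_false] at hv
      rcases hv with rfl | rfl | rfl | rfl | rfl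
      · simp [hP.adj_leaf.ne', hmp.symm]
      all_goals assumption
    rw [List.toFinset_card_of_nodup hnd,
      Finset.card_sdiff_of_subset (Finset.subset_univ _), Finset.card_pair hlm,
      Finset.card_univ, h6] at h₁
    simp at h₁

end SimpleGraph

/-! ### Components, free graphs and disjoint unions -/

namespace SimpleGraph

section Components

variable {W : Type*} [Fintype W] {G : SimpleGraph W} {d : ℕ}

lemma IsRegularOfDegree.even_card_of_odd [DecidableEq W] [DecidableRel G.Adj]
    (hd : G.IsRegularOfDegree d) (hodd : Odd d) : Even (Fintype.card W) := by
  have h := G.sum_degrees_eq_twice_card_edges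
  simp only [hd.degree_eq, Finset.sum_const, Finset.card_univ, smul_eq_mul] at h
  have h2 : Even (Fintype.card W * d) := ⟨_, h.trans (two_mul _)⟩
  exact (Nat.even_mul.1 h2).resolve_right (Nat.not_even_iff_odd.2 hodd)

/-- A `d`-regular graph whose order is not a multiple of `d + 1` has a connected component of order
greater than `d + 1`. -/
lemma IsRegularOfDegree.exists_large_component [DecidableEq W] [DecidableRel G.Adj]
    (hd : G.IsRegularOfDegree d) (hdvd : ¬ d + 1 ∣ Fintype.card W) :
    ∃ (s : Set W) (_ : Fintype s) (_ : DecidableEq s) (_ : DecidableRel (G.induce s).Adj),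
      (G.induce s).Connected ∧ (G.induce s).IsRegularOfDegree d ∧ d + 1 < Fintype.card s := by
  classical
  have hreg : ∀ c : G.ConnectedComponent, (G.induce c.supp).IsRegularOfDegree d := by
    intro c v
    rw [← hd v, ← card_neighborFinset_eq_degree, ← card_neighborFinset_eq_degree,
      ← Finset.card_map (Function.Embedding.subtype _)]
    congr 1
    ext w
    simp only [Finset.mem_map, mem_neighborFinset, Function.Embedding.subtype_apply]
    constructor
    · rintro ⟨a, ha, rfl⟩
      exact ha
    · intro hw
      exact ⟨⟨w, c.mem_supp_of_adj_mem_supp v.2 hw⟩, hw, rfl⟩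
  by_contra! hcon
  have hle : ∀ c : G.ConnectedComponent, Fintype.card c.supp = d + 1 := by
    intro c
    refine le_antisymm (hcon c.supp inferInstance inferInstance inferInstance c.connected_toSimpleGraph ?_) ?_
    · exact hreg c
    · obtain ⟨v⟩ := c.connected_toSimpleGraph.nonempty
      have := (G.induce c.supp).degree_lt_card_verts v
      rw [hreg c v] at this
      exact this
  apply hdvd
  have h := Fintype.card_congr (Equiv.sigmaFiberEquiv G.connectedComponentMk)
  rw [Fintype.card_sigma] at h
  rw [← h]
  refine Finset.dvd_sum fun c _ ↦ ?_
  rw [← hle c]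
  refine (Fintype.card_congr (Equiv.subtypeEquivRight fun v ↦ ?_)).dvd
  simp [ConnectedComponent.mem_supp_iff]

end Components

section Free

variable {V W : Type*} {T : SimpleGraph V} {G : SimpleGraph W} {d : ℕ}

lemma Preconnected.eq_of_forall_adj {α : Type*} (hT : T.Preconnected) {P : V → α}
    (h : ∀ u v, T.Adj u v → P u = P v) (u v : V) : P u = P v := by
  obtain ⟨w⟩ := hT u v
  induction w with
  | nil => rfl
  | cons hadj _ ih => exact (h _ _ hadj).trans ih

lemma free_of_card_lt [Fintype V] [Fintype W] (h : Fintype.card W < Fintype.card V) :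
    T.Free G :=
  fun ⟨f⟩ ↦ absurd (Fintype.card_le_of_injective f f.injective) (by lia)

/-- A connected graph contained in a disjoint union is contained in one of the two parts. -/
lemma Connected.free_sum {U : Type*} {H : SimpleGraph U} (hT : T.Connected) (hG : T.Free G)
    (hH : T.Free H) : T.Free (G ⊕g H) := by
  rintro ⟨f⟩
  have hadj : ∀ u v, T.Adj u v → (G ⊕g H).Adj (f u) (f v) := fun u v h ↦ f.toHom.map_adj h
  have hside := hT.preconnected.eq_of_forall_adj (P := fun v ↦ (f v).isLeft) (by
    intro u v huv
    have := hadj u v huv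
    cases hu : f u <;> cases hv : f v <;> simp_all)
  obtain ⟨c⟩ := hT.nonempty
  cases hc : f c with
  | inl a =>
    have : ∀ v, ∃ w, f v = Sum.inl w := fun v ↦ by
      have := hside v c
      cases hv : f v <;> simp_all
    choose g hg using this
    refine hG ⟨⟨⟨g, fun {u v} huv ↦ ?_⟩, fun u v huv ↦ f.injective ?_⟩⟩
    · have := hadj u v huv
      rwa [hg, hg, sum_adj_inl] at this
    · change g u = g v at huv
      change f u = f v
      rw [hg, hg, huv]
  | inr a =>
    have : ∀ v, ∃ w, f v = Sum.inr w := fun v ↦ by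
      have := hside v c
      cases hv : f v <;> simp_all
    choose g hg using this
    refine hH ⟨⟨⟨g, fun {u v} huv ↦ ?_⟩, fun u v huv ↦ f.injective ?_⟩⟩
    · have := hadj u v huv
      rwa [hg, hg, sum_adj_inr] at this
    · change g u = g v at huv
      change f u = f v
      rw [hg, hg, huv]

lemma IsRegularOfDegree.free_of_isStar [Fintype V] [G.LocallyFinite] (hd : G.IsRegularOfDegree d)
    (hV : d + 1 < Fintype.card V) (hstar : IsStar T) : T.Free G := by
  classical
  obtain ⟨c, rfl⟩ := hstar
  rintro ⟨f⟩
  have := f.degree_le c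
  rw [hd, degree_starGraph_center] at this
  lia

/-- An almost-star on at least `d + 3` vertices is not contained in the complete bipartite graph
with classes of order `d`. -/
lemma free_completeBipartiteGraph_of_isAlmostStar [Fintype V] (hV : d + 3 ≤ Fintype.card V)
    (hT : IsAlmostStar T) : T.Free (completeBipartiteGraph (Fin d) (Fin d)) := by
  classical
  obtain ⟨hT, C, i, hCi⟩ := hT
  rintro ⟨f⟩
  -- the given coloring and the one by the sides of the bipartite graph agree
  have hside := hT.connected.preconnected.eq_of_forall_adj
    (P := fun v ↦ decide (C v = i) ^^ (f v).isLeft) (by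
    intro u v huv
    have h₁ : (completeBipartiteGraph (Fin d) (Fin d)).Adj (f u) (f v) := f.toHom.map_adj huv
    have h₂ : C u ≠ C v := C.valid huv
    have h₃ : C u = i ↔ C v ≠ i := by lia
    cases hu : f u <;> cases hv : f v <;> by_cases h : C v = i <;> simp_all)
  have hsmall : (Finset.univ.filter fun v ↦ C v = i).card ≤ 2 := by
    have : (C.colorClass i) = ((Finset.univ.filter fun v ↦ C v = i : Finset V) : Set V) := by
      ext v
      rw [Finset.mem_coe, Finset.mem_filter]
      exact ⟨fun h ↦ ⟨Finset.mem_univ v, h⟩, fun h ↦ h.2⟩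
    rw [this, Set.encard_coe_eq_coe_finsetCard] at hCi
    exact_mod_cast hCi
  have hother : (Finset.univ.filter fun v ↦ ¬ C v = i).card ≤ d := by
    have hinj : Set.InjOn (fun v ↦ (f v).elim id id)
        ((Finset.univ.filter fun v ↦ ¬ C v = i : Finset V) : Set V) := by
      intro u hu v hv huv
      have := hside u v
      apply f.injective
      cases hu' : f u <;> cases hv' : f v <;> simp_all
    have := Finset.card_le_card_of_injOn (t := Finset.univ) _ (fun _ _ ↦ Finset.mem_univ _) hinj
    simpa using this
  have := Finset.card_filter_add_card_filter_not (s := Finset.univ) (fun v ↦ C v = i)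
  rw [Finset.card_univ] at this
  lia

end Free

end SimpleGraph

section Constructions

open SimpleGraph

variable {V : Type*} {T : SimpleGraph V} {d : ℕ}

lemma mem_regularFreeDegrees_card {α : Type*} [Fintype α] {G : SimpleGraph α} [G.LocallyFinite]
    (hd : G.IsRegularOfDegree d) (hT : T.Free G) :
    d ∈ regularFreeDegrees (Fintype.card α) T := by
  classical
  let e := Iso.comap (Fintype.equivFin α).symm G
  refine ⟨_, inferInstance, fun v ↦ ?_, (free_congr_right e).2 hT⟩
  rw [← e.degree_eq, hd]

lemma exists_of_mem_regularFreeDegrees {n : ℕ} (h : d ∈ regularFreeDegrees n T) :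
    ∃ (G : SimpleGraph (Fin n)) (_ : DecidableRel G.Adj), G.IsRegularOfDegree d ∧ T.Free G := by
  classical
  obtain ⟨G, hG, hd, hT⟩ := h
  refine ⟨G, inferInstance, ?_, hT⟩
  convert! hd

lemma zero_mem_regularFreeDegrees (hT : T.Connected) : d ∈ regularFreeDegrees 0 T :=
  ⟨⊥, inferInstance, fun v ↦ v.elim0, fun ⟨f⟩ ↦ (f hT.nonempty.some).elim0⟩

lemma add_mem_regularFreeDegrees (hT : T.Connected) {a b : ℕ} (ha : d ∈ regularFreeDegrees a T)
    (hb : d ∈ regularFreeDegrees b T) : d ∈ regularFreeDegrees (a + b) T := by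
  classical
  obtain ⟨G, _, hGd, hG⟩ := exists_of_mem_regularFreeDegrees ha
  obtain ⟨H, _, hHd, hH⟩ := exists_of_mem_regularFreeDegrees hb
  have h := mem_regularFreeDegrees_card (G := G ⊕g H) (d := d) (T := T) ?_ (hT.free_sum hG hH)
  · simpa using h
  · rintro (v | v)
    · have : (G ⊕g H).neighborFinset (Sum.inl v) =
          (G.neighborFinset v).map Function.Embedding.inl := by
        ext (w | w) <;> simp
      rw [← card_neighborFinset_eq_degree, this, Finset.card_map, card_neighborFinset_eq_degree,
        hGd v]
    · have : (G ⊕g H).neighborFinset (Sum.inr v) =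
          (H.neighborFinset v).map Function.Embedding.inr := by
        ext (w | w) <;> simp
      rw [← card_neighborFinset_eq_degree, this, Finset.card_map, card_neighborFinset_eq_degree,
        hHd v]

lemma mul_mem_regularFreeDegrees (hT : T.Connected) {a : ℕ} (ha : d ∈ regularFreeDegrees a T)
    (k : ℕ) : d ∈ regularFreeDegrees (k * a) T := by
  induction k with
  | zero => simpa using zero_mem_regularFreeDegrees hT
  | succ k ih =>
    rw [Nat.succ_mul]
    exact add_mem_regularFreeDegrees hT ih ha

lemma mem_regularFreeDegrees_of_gcd_dvd (hT : T.Connected) {a b n : ℕ}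
    (ha : d ∈ regularFreeDegrees a T) (hb : d ∈ regularFreeDegrees b T) (hn : a.gcd b ∣ n)
    (hle : a * b ≤ n) : d ∈ regularFreeDegrees n T := by
  obtain ⟨i, j, rfl⟩ := Nat.exists_add_mul_eq_of_gcd_dvd_of_mul_pred_le a b n hn
    ((Nat.mul_le_mul (Nat.pred_le a) (Nat.pred_le b)).trans hle)
  exact add_mem_regularFreeDegrees hT (mul_mem_regularFreeDegrees hT ha i)
    (mul_mem_regularFreeDegrees hT hb j)

lemma mem_regularFreeDegrees_top (h : T.Free (⊤ : SimpleGraph (Fin (d + 1)))) :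
    d ∈ regularFreeDegrees (d + 1) T := by
  classical
  have := mem_regularFreeDegrees_card (d := d) (fun v ↦ by simp) h
  simpa using this

/-- The complete graph on `2 * k` vertices minus a perfect matching. -/
def cocktailPartyGraph (k : ℕ) : SimpleGraph (Fin k × Fin 2) :=
  (⊤ : SimpleGraph (Fin k)).comap Prod.fst

instance (k : ℕ) : DecidableRel (cocktailPartyGraph k).Adj :=
  inferInstanceAs (DecidableRel fun a b : Fin k × Fin 2 ↦ (⊤ : SimpleGraph (Fin k)).Adj a.1 b.1)

lemma isRegularOfDegree_cocktailPartyGraph (k : ℕ) :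
    (cocktailPartyGraph (k + 1)).IsRegularOfDegree (2 * k) := by
  intro v
  have : (cocktailPartyGraph (k + 1)).neighborFinset v =
      (Finset.univ.erase v.1) ×ˢ (Finset.univ : Finset (Fin 2)) := by
    ext w
    rw [mem_neighborFinset]
    simp [cocktailPartyGraph, eq_comm]
  rw [← card_neighborFinset_eq_degree, this, Finset.card_product,
    Finset.card_erase_of_mem (Finset.mem_univ _)]
  simp [mul_comm]

lemma isRegularOfDegree_completeBipartiteGraph (d : ℕ) [(completeBipartiteGraph (Fin d)
    (Fin d)).LocallyFinite] : (completeBipartiteGraph (Fin d) (Fin d)).IsRegularOfDegree d := by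
  classical
  rintro (v | v)
  · have : (completeBipartiteGraph (Fin d) (Fin d)).neighborFinset (Sum.inl v) =
        Finset.univ.map Function.Embedding.inr := by
      ext (w | w) <;> simp
    rw [← card_neighborFinset_eq_degree, this]
    simp
  · have : (completeBipartiteGraph (Fin d) (Fin d)).neighborFinset (Sum.inr v) =
        Finset.univ.map Function.Embedding.inl := by
      ext (w | w) <;> simp
    rw [← card_neighborFinset_eq_degree, this]
    simp

/-- For an even degree, disjoint unions of complete graphs and of complete graphs minus a perfect
matching reach every large order. -/
lemma mem_regularFreeDegrees_of_even {k n : ℕ} (hT : T.Connected)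
    (h₁ : T.Free (⊤ : SimpleGraph (Fin (2 * k + 1)))) (h₂ : T.Free (cocktailPartyGraph (k + 1)))
    (hn : (2 * k + 2) * (2 * k + 2) ≤ n) : 2 * k ∈ regularFreeDegrees n T := by
  have hb := mem_regularFreeDegrees_card (isRegularOfDegree_cocktailPartyGraph k) h₂
  have hcard : Fintype.card (Fin (k + 1) × Fin 2) = 2 * k + 1 + 1 := by simp; ring
  rw [hcard] at hb
  exact mem_regularFreeDegrees_of_gcd_dvd hT (mem_regularFreeDegrees_top h₁) hb (by simp)
    (by nlinarith)

/-- Disjoint unions of complete graphs and of balanced complete bipartite graphs reach every large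
even order. -/
lemma mem_regularFreeDegrees_of_even_order {n : ℕ} (hT : T.Connected)
    (h₁ : T.Free (⊤ : SimpleGraph (Fin (d + 1))))
    (h₂ : T.Free (completeBipartiteGraph (Fin d) (Fin d))) (hn : Even n)
    (hle : (d + 1) * (d + d) ≤ n) : d ∈ regularFreeDegrees n T := by
  classical
  have hb := mem_regularFreeDegrees_card (isRegularOfDegree_completeBipartiteGraph d) h₂
  have hcard : Fintype.card (Fin d ⊕ Fin d) = d + d := by simp
  rw [hcard] at hb
  refine mem_regularFreeDegrees_of_gcd_dvd hT (mem_regularFreeDegrees_top h₁) hb ?_ hle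
  refine dvd_trans ?_ hn.two_dvd
  -- the greatest common divisor divides `2 * (d + 1) - 2 * d = 2`
  have h := Nat.dvd_sub ((Nat.gcd_dvd_left (d + 1) (d + d)).mul_left 2)
    (Nat.gcd_dvd_right (d + 1) (d + d))
  rwa [show 2 * (d + 1) - (d + d) = 2 by lia] at h

end Constructions

/-! ### Attained degrees -/

section Bounds

open SimpleGraph

variable {V : Type*} [Fintype V] {T : SimpleGraph V} {d n : ℕ}

lemma add_two_le_card_of_mem_regularFreeDegrees (hT : T.IsTree) (hn : 0 < n)
    (h : d ∈ regularFreeDegrees n T) : d + 2 ≤ Fintype.card V := by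
  classical
  obtain ⟨G, _, hd, hfree⟩ := exists_of_mem_regularFreeDegrees h
  by_contra! hlt
  obtain ⟨c⟩ := hT.connected.nonempty
  have h₀ : PartialCopy T G {c} (fun _ ↦ ⟨0, hn⟩) := .singleton c
  obtain ⟨φ, hφ, -⟩ := h₀.exists_extend (fun x ↦ (hd x).ge) hT.isAcyclic (S' := Finset.univ)
    (hT.connected.preconnected.induce_of_degree_eq_one fun v hv ↦ (hv (by simp)).elim)
    (by rw [Finset.card_univ]; lia) (by simp) (by simp)
  exact hfree hφ.isContained

omit [Fintype V] in
lemma even_of_odd_of_mem_regularFreeDegrees (h : d ∈ regularFreeDegrees n T) (hd : Odd d) :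
    Even n := by
  obtain ⟨G, _, hG, -⟩ := exists_of_mem_regularFreeDegrees h
  simpa using hG.even_card_of_odd hd

/-- A `T`-free regular graph of degree `t - 2` exists only in the first case. -/
lemma topCase_of_mem_regularFreeDegrees (hT : T.IsTree) (hV : Fintype.card V = d + 2)
    (h : d ∈ regularFreeDegrees n T) : TopCase T (d + 2) n := by
  classical
  by_contra hcon
  simp only [TopCase, not_or, not_and, Nat.not_even_iff_odd] at hcon
  obtain ⟨hdvd, hs⟩ := hcon
  by_cases hstar : IsStar T
  · have h₁ := hs hstar
    have h₂ := even_of_odd_of_mem_regularFreeDegrees h (by grind)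
    exact (Nat.not_even_iff_odd.2 h₁.2) h₂
  · obtain ⟨G, _, hG, hfree⟩ := exists_of_mem_regularFreeDegrees h
    obtain ⟨s, _, _, _, hconn, hreg, hcard⟩ := hG.exists_large_component (by simpa using hdvd)
    exact hfree ((hconn.isContained_of_not_isStar hreg hcard hT hV hstar).trans
      ⟨Copy.induce G s⟩)

/-- A `T`-free regular graph of degree `t - 3` exists only if the conditions of the second case
hold. -/
lemma middleCase_of_mem_regularFreeDegrees (hT : T.IsTree) (hV : Fintype.card V = d + 3)
    (h : d ∈ regularFreeDegrees n T) : MiddleCase T (d + 3) n := by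
  classical
  by_contra hcon
  simp only [MiddleCase, not_or, not_and, Nat.not_odd_iff_even] at hcon
  obtain ⟨heven, hdvd, hstar, halmost⟩ := hcon
  have hodd : Odd d := by grind
  have hn := even_of_odd_of_mem_regularFreeDegrees h hodd
  obtain ⟨G, _, hG, hfree⟩ := exists_of_mem_regularFreeDegrees h
  obtain ⟨s, _, _, _, hconn, hreg, hcard⟩ := hG.exists_large_component (by simpa using hdvd)
  -- by parity, the order of the component is at least `d + 3` rather than `d + 2`
  have hs := hreg.even_card_of_odd hodd
  obtain ⟨C⟩ := hT.colorable_two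
  refine hfree ((hconn.isContained_of_three_le_colorClass hreg (by grind) hT hV hstar C
    fun i ↦ ?_).trans ⟨Copy.induce G s⟩)
  by_contra! hlt
  refine halmost ⟨hT, C, i, ?_⟩ hn
  have : (C.colorClass i) = ((Finset.univ.filter fun v ↦ C v = i : Finset V) : Set V) := by
    ext v
    rw [Finset.mem_coe, Finset.mem_filter]
    exact ⟨fun h ↦ ⟨Finset.mem_univ v, h⟩, fun h ↦ h.2⟩
  rw [this, Set.encard_coe_eq_coe_finsetCard]
  exact_mod_cast Nat.le_of_lt_succ hlt

lemma mem_regularFreeDegrees_of_dvd (hT : T.Connected) (hV : d + 1 < Fintype.card V)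
    (h : d + 1 ∣ n) : d ∈ regularFreeDegrees n T := by
  obtain ⟨k, rfl⟩ := h
  rw [mul_comm]
  exact mul_mem_regularFreeDegrees hT
    (mem_regularFreeDegrees_top (free_of_card_lt (by simpa using hV))) k

lemma mem_regularFreeDegrees_of_topCase (hT : T.Connected) (hV : Fintype.card V = d + 2)
    (hn : (2 * d + 2) * (2 * d + 2) ≤ n) (h : TopCase T (d + 2) n) :
    d ∈ regularFreeDegrees n T := by
  classical
  rcases h with h | ⟨hstar, h⟩
  · exact mem_regularFreeDegrees_of_dvd hT (by lia) (by simpa using h)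
  have htop : T.Free (⊤ : SimpleGraph (Fin (d + 1))) := free_of_card_lt (by simp; lia)
  by_cases hd : Even d
  · obtain ⟨k, rfl⟩ := hd
    rw [← two_mul] at htop hV hn ⊢
    exact mem_regularFreeDegrees_of_even hT htop
      ((isRegularOfDegree_cocktailPartyGraph k).free_of_isStar (by lia) hstar) (by nlinarith)
  · exact mem_regularFreeDegrees_of_even_order hT htop
      ((isRegularOfDegree_completeBipartiteGraph d).free_of_isStar (by lia) hstar)
      (h.resolve_left (by grind)) (by nlinarith)

/-- For even `d`, the pieces of order `d + 1` and `d + 2` are too small to contain a tree on more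
than `d + 2` vertices. -/
lemma mem_regularFreeDegrees_of_even_degree (hT : T.Connected) (hV : d + 2 < Fintype.card V)
    (hn : (2 * d + 2) * (2 * d + 2) ≤ n) (hd : Even d) : d ∈ regularFreeDegrees n T := by
  obtain ⟨k, rfl⟩ := hd
  rw [← two_mul] at hV hn ⊢
  exact mem_regularFreeDegrees_of_even hT (free_of_card_lt (by simp; lia))
    (free_of_card_lt (by simp; lia)) (by nlinarith)

lemma mem_regularFreeDegrees_of_middleCase (hT : T.Connected) (hV : Fintype.card V = d + 3)
    (hn : (2 * d + 2) * (2 * d + 2) ≤ n) (htop : ¬ TopCase T (d + 3) n)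
    (h : MiddleCase T (d + 3) n) : d ∈ regularFreeDegrees n T := by
  by_cases hd : Even d
  · exact mem_regularFreeDegrees_of_even_degree hT (by lia) hn hd
  have hd' : Even (d + 3) := by grind
  rcases h with h | h | h | ⟨h, hn'⟩
  · exact (Nat.not_odd_iff_even.2 hd' h).elim
  · exact mem_regularFreeDegrees_of_dvd hT (by lia) (by simpa using h)
  · exact (htop (.inr ⟨h, .inl hd'⟩)).elim
  · exact mem_regularFreeDegrees_of_even_order hT (free_of_card_lt (by simp; lia))
      (free_completeBipartiteGraph_of_isAlmostStar hV.ge h) hn' (by nlinarith)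

end Bounds

theorem theorem3 {V : Type*} [Fintype V] (T : SimpleGraph V) (hT : T.IsTree)
    (t : ℕ) (ht : Fintype.card V = t) (ht2 : 2 ≤ t) :
    ∃ n₀ : ℕ, ∀ n : ℕ, n₀ < n →
      IsGreatest (regularFreeDegrees n T) (regex n T) ∧
      (TopCase T t n → (regex n T : ℤ) = (t : ℤ) - 2) ∧
      (¬ TopCase T t n → MiddleCase T t n → (regex n T : ℤ) = (t : ℤ) - 3) ∧
      (¬ TopCase T t n → ¬ MiddleCase T t n → (regex n T : ℤ) = (t : ℤ) - 4) := by
  refine ⟨(2 * t + 2) * (2 * t + 2), fun n hn ↦ ?_⟩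
  have hbound : ∀ d, d ≤ t → (2 * d + 2) * (2 * d + 2) ≤ n := fun d hd ↦ by nlinarith
  have hle : ∀ r ∈ regularFreeDegrees n T, r + 2 ≤ t := fun r hr ↦
    ht ▸ add_two_le_card_of_mem_regularFreeDegrees hT (by lia) hr
  have htop : t - 2 ∈ regularFreeDegrees n T → TopCase T t n := fun h ↦ by
    have := topCase_of_mem_regularFreeDegrees hT (by lia) h
    rwa [Nat.sub_add_cancel ht2] at this
  have heq : ∀ k, IsGreatest (regularFreeDegrees n T) k → regex n T = k := fun k hk ↦ hk.csSup_eq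
  by_cases h₁ : TopCase T t n
  · have hmem : t - 2 ∈ regularFreeDegrees n T :=
      mem_regularFreeDegrees_of_topCase hT.connected (by lia) (hbound _ (by lia))
        (by rwa [Nat.sub_add_cancel ht2])
    have hg : IsGreatest (regularFreeDegrees n T) (t - 2) :=
      ⟨hmem, fun r hr ↦ by have := hle r hr; lia⟩
    rw [heq _ hg]
    exact ⟨hg, fun _ ↦ by lia, fun h ↦ (h h₁).elim, fun h ↦ (h h₁).elim⟩
  -- for `t = 2` the first case applies, as `t - 1 = 1` divides `n`
  have ht3 : 3 ≤ t := by
    by_contra! hlt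
    obtain rfl : t = 2 := by lia
    exact h₁ (.inl (by simp))
  have hle' : ∀ r ∈ regularFreeDegrees n T, r + 3 ≤ t := fun r hr ↦ by
    have := hle r hr
    by_contra! hlt
    obtain rfl : r = t - 2 := by lia
    exact h₁ (htop hr)
  by_cases h₂ : MiddleCase T t n
  · have hmem : t - 3 ∈ regularFreeDegrees n T :=
      mem_regularFreeDegrees_of_middleCase hT.connected (by lia) (hbound _ (by lia))
        (by rwa [Nat.sub_add_cancel ht3]) (by rwa [Nat.sub_add_cancel ht3])
    have hg : IsGreatest (regularFreeDegrees n T) (t - 3) :=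
      ⟨hmem, fun r hr ↦ by have := hle' r hr; lia⟩
    rw [heq _ hg]
    exact ⟨hg, fun h ↦ (h₁ h).elim, fun _ _ ↦ by lia, fun _ h ↦ (h h₂).elim⟩
  have heven : Even t := Nat.not_odd_iff_even.1 fun h ↦ h₂ (.inl h)
  have ht4 : 4 ≤ t := by
    obtain ⟨k, rfl⟩ := heven
    lia
  have hmem : t - 4 ∈ regularFreeDegrees n T :=
    mem_regularFreeDegrees_of_even_degree hT.connected (by lia) (hbound _ (by lia))
      (by grind)
  have hg : IsGreatest (regularFreeDegrees n T) (t - 4) := by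
    refine ⟨hmem, fun r hr ↦ ?_⟩
    have := hle' r hr
    by_contra! hlt
    obtain rfl : r = t - 3 := by lia
    have := middleCase_of_mem_regularFreeDegrees hT (by lia) hr
    rw [Nat.sub_add_cancel ht3] at this
    exact h₂ this
  rw [heq _ hg]
  exact ⟨hg, fun h ↦ (h₁ h).elim, fun _ h ↦ (h₂ h).elim, fun _ _ ↦ by lia⟩
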